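/- Let $n,k\ge 1$ be integers with $m:=kn-1\ge 1$. **Parking functions.** For $M\ge1$, $\mathrm{PF}_{M/n}$ is the set of functions $f:\{1,\dots,n\}\to\mathbb Z_{\ge 0}$ such that the Young diagram whose row lengths, from bottom to top, are $f(1),\dots,f(n)$ put in weakly decreasing order fits under the diagonal (from the upper left to the lower right corner) of the rectangle of height $n$ and width $M$. **Affine permutations.** An affine permutation is a bijection $\omega:\mathbb Z\to\mathbb Z$ with $\omega(x+n)=\omega(x)+n$ for all $x$ and $\sum_{i=1}^n\omega(i)=\frac{n(n+1)}2$. It is $m$-stable if $\omega(x+m)>\omega(x)$ for all $x$; $\widetilde S_n^{m}$ denotes the set of $m$-stable affine permutations. For $\omega\in\widetilde S_n^m$ and $\alpha\in\{1,\dots,n\}$ put $$\mathrm{PS}_\omega(\alpha)=\#\{\beta\in\mathbb Z:\ \beta>\alpha,\ 0<\omega^{-1}(\alpha)-\omega^{-1}(\beta)<m\}.$$ **Alcoves.** Let $V=\{x\in\mathbb R^n: x_1+\dots+x_n=0\}$ and $H_{ij}^\ell=\{x\in V: x_i-x_j=\ell\}$. The alcoves are the connected components of the complement in $V$ of all $H_{ij}^\ell$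 ($1\le i<j\le n$, $\ell\in\mathbb Z$); the fundamental alcove is $A_0=\{x\in V: x_1>\dots>x_n>x_1-1\}$. An affine permutation acts on $V$ by $(\omega x)_i=x_{\omega^{-1}(i)}$, where coordinates are extended to integer indices by $x_{j+n}=x_j-1$. **Shi regions.** The $k$-Shi regions are the connected components of the complement in $V$ of the $k$-Shi arrangement $\{H_{ij}^\ell: 1\le i<j\le n,\ -k<\ell\le k\}$. Let $\widehat{\mathrm{Reg}}$ be the set of bounded $k$-Shi regions. For a hyperplane $H_{ij}^\ell$, let $H_{ij}^{\ell,\succ}$ be its open half-space in $V$ not containing $A_0$. The Pak–Stanley label of a $k$-Shi region $R$ is the function $\lambda_R:\{1,\dots,n\}\to\mathbb Z_{\ge0}$ given by $$\lambda_R(a)=\#\{H_{ij}^\ell: i<j,\ -k<\ell\le 0,\ R\subseteq H_{ij}^{\ell,\succ},\ i=a\}+\#\{H_{ij}^\ell: i<j,\ 0<\ell\le k,\ R\subseteq H_{ij}^{\ell,\succ},\ j=a\}.$$ A maximal alcove of a region $R$ is an alcove contained in $R$ that, among all alcoves contained in $R$, is separated from $A_0$ by the greatest number of hyperplanes $H_{ij}^\ell$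 ($i<j$, $\ell\in\mathbb Z$). **Theorem.** 1. For every $\omega\in\widetilde S_n^{kn-1}$ there is exactly one bounded $k$-Shi region $\mathrm{balc}(\omega)$ of which $\omega(A_0)$ is a maximal alcove, and $\mathrm{balc}:\widetilde S_n^{kn-1}\to\widehat{\mathrm{Reg}}$ is a bijection. 2. The image of $\widehat{\mathrm{Reg}}$ under the Pak–Stanley labeling $R\mapsto\lambda_R$ is exactly $\mathrm{PF}_{(kn-1)/n}$, which is contained in $\mathrm{PF}_{(kn+1)/n}$. 3. $\lambda\circ\mathrm{balc}=\mathrm{PS}$ on $\widetilde S_n^{kn-1}$. 4. $\mathrm{PS}$ is a bijection from $\widetilde S_n^{kn-1}$ onto $\mathrm{PF}_{(kn-1)/n}$. -/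

import Mathlib

/-! Indices: the coordinates `x_1, …, x_n` and the values `f(1), …, f(n)` are indexed by `Fin n`,
the element `i : Fin n` standing for the integer `i + 1`. -/

/-- The set `PF_{m/n}` of `m/n`-parking functions.  Rearrange the values of `f` into a weakly
decreasing sequence and use it as the row lengths, from bottom to top, of a Young diagram in the
lower left corner of the rectangle with height `n` and width `m`.  The diagram lies under the
diagonal from `(0, n)` to `(m, 0)` iff the upper right corner `(f (σ i), i + 1)` of each row
(`i = 0` is the bottom row) satisfies `f (σ i) / m + (i + 1) / n ≤ 1`. -/
def parkingFunctions (m n : ℕ) : Set (Fin n → ℕ) :=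
  {f | ∃ σ : Equiv.Perm (Fin n), Antitone (f ∘ σ) ∧
    ∀ i : Fin n, n * f (σ i) + m * ((i : ℕ) + 1) ≤ m * n}

/-- The affine permutations: bijections `ω` of `ℤ` with `ω (x + n) = ω x + n` and
`ω 1 + … + ω n = n (n + 1) / 2`. -/
def affinePerms (n : ℕ) : Set (Equiv.Perm ℤ) :=
  {ω | (∀ x : ℤ, ω (x + n) = ω x + n) ∧
    2 * ∑ i ∈ Finset.Icc (1 : ℤ) n, ω i = n * (n + 1)}

/-- The `m`-stable affine permutations: those with `ω (x + m) > ω x` for all `x`. -/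
def stablePerms (m n : ℕ) : Set (Equiv.Perm ℤ) :=
  {ω | ω ∈ affinePerms n ∧ ∀ x : ℤ, ω x < ω (x + m)}

/-- `PS_ω(α) = #{β > α : 0 < ω⁻¹ α - ω⁻¹ β < m}` for `α = a + 1 ∈ {1, …, n}`. -/
noncomputable def psMap (m n : ℕ) (ω : Equiv.Perm ℤ) : Fin n → ℕ := fun a =>
  Set.ncard {β : ℤ | (a : ℤ) + 1 < β ∧ 0 < ω⁻¹ ((a : ℤ) + 1) - ω⁻¹ β ∧
    ω⁻¹ ((a : ℤ) + 1) - ω⁻¹ β < m}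

/-- The space `V` of vectors in `ℝⁿ` with coordinate sum zero. -/
def sumZero (n : ℕ) : Set (Fin n → ℝ) := {x | ∑ i, x i = 0}

/-- The hyperplane `H_{ij}^ℓ = {x ∈ V : x_i - x_j = ℓ}` of `V`. -/
def hyperplane {n : ℕ} (i j : Fin n) (l : ℤ) : Set (Fin n → ℝ) :=
  {x | x ∈ sumZero n ∧ x i - x j = l}

/-- The affine braid arrangement. -/
def affineBraid (n : ℕ) : Set (Set (Fin n → ℝ)) :=
  {H | ∃ (i j : Fin n) (l : ℤ), i < j ∧ H = hyperplane i j l}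

/-- The `k`-Shi arrangement `{H_{ij}^ℓ : i < j, -k < ℓ ≤ k}`. -/
def shiArrangement (n k : ℕ) : Set (Set (Fin n → ℝ)) :=
  {H | ∃ (i j : Fin n) (l : ℤ), i < j ∧ -(k : ℤ) < l ∧ l ≤ k ∧ H = hyperplane i j l}

/-- The connected components of the complement in `V` of an arrangement of hyperplanes. -/
def regions {n : ℕ} (𝓐 : Set (Set (Fin n → ℝ))) : Set (Set (Fin n → ℝ)) :=
  {R | ∃ x ∈ sumZero n \ ⋃₀ 𝓐, R = connectedComponentIn (sumZero n \ ⋃₀ 𝓐) x}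

/-- The alcoves. -/
def alcoves (n : ℕ) : Set (Set (Fin n → ℝ)) := regions (affineBraid n)

/-- The bounded `k`-Shi regions. -/
def boundedShiRegions (n k : ℕ) : Set (Set (Fin n → ℝ)) :=
  {R | R ∈ regions (shiArrangement n k) ∧ Bornology.IsBounded R}

/-- The fundamental alcove `{x ∈ V : x_1 > x_2 > … > x_n > x_1 - 1}`. -/
def fundamentalAlcove (n : ℕ) : Set (Fin n → ℝ) :=
  {x | x ∈ sumZero n ∧ StrictAnti x ∧ ∀ i j, x i - 1 < x j}

/-- The open half-space `H_{ij}^{ℓ,≻}` of `V`: the points lying strictly on the other side of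
`H_{ij}^ℓ` from the fundamental alcove. -/
def farSide {n : ℕ} (i j : Fin n) (l : ℤ) : Set (Fin n → ℝ) :=
  {x | x ∈ sumZero n ∧ ∀ y ∈ fundamentalAlcove n, (x i - x j - l) * (y i - y j - l) < 0}

/-- The Pak–Stanley label of `R`: crossing `H_{ij}^ℓ` (`i < j`, `-k < ℓ ≤ k`) away from the
fundamental alcove adds `1` to the `i`-th value if `ℓ ≤ 0` and to the `j`-th value if `ℓ > 0`. -/
noncomputable def pakStanley (n k : ℕ) (R : Set (Fin n → ℝ)) : Fin n → ℕ := fun a =>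
  Set.ncard {p : Fin n × ℤ | a < p.1 ∧ -(k : ℤ) < p.2 ∧ p.2 ≤ 0 ∧ R ⊆ farSide a p.1 p.2} +
  Set.ncard {p : Fin n × ℤ | p.1 < a ∧ 0 < p.2 ∧ p.2 ≤ k ∧ R ⊆ farSide p.1 a p.2}

/-- The coordinates `x_j` of a vector, extended to all integers `j` by `x_{j+n} = x_j - 1`. -/
noncomputable def extCoord {n : ℕ} [NeZero n] (x : Fin n → ℝ) (j : ℤ) : ℝ :=
  x (Fin.ofNat n ((j - 1) % n).toNat) - ((j - 1) / n : ℤ)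

theorem extCoord_add {n : ℕ} [NeZero n] (x : Fin n → ℝ) (j : ℤ) :
    extCoord x (j + n) = extCoord x j - 1 := by
  have hn : (n : ℤ) ≠ 0 := by exact_mod_cast NeZero.ne n
  have h : j + n - 1 = (j - 1) + n := by ring
  simp only [extCoord, h, Int.add_emod_right, Int.add_ediv_of_dvd_right (dvd_refl (n : ℤ)),
    Int.ediv_self hn]
  push_cast
  ring

theorem extCoord_coe {n : ℕ} [NeZero n] (x : Fin n → ℝ) (i : Fin n) :
    extCoord x ((i : ℤ) + 1) = x i := by
  have h1 : ((i : ℤ)) % n = i := by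
    have := i.isLt
    exact Int.emod_eq_of_lt (by positivity) (by exact_mod_cast this)
  have h2 : ((i : ℤ)) / n = 0 := by
    have := i.isLt
    exact Int.ediv_eq_zero_of_lt (by positivity) (by exact_mod_cast this)
  simp [extCoord, h1, h2, Fin.ofNat, Nat.mod_eq_of_lt i.isLt]

/-- The action of an affine permutation on vectors: `(ω x)_i = x_{ω⁻¹ i}` in terms of the extended
coordinates.  The simple transposition `s_i` acts by exchanging `x_i` and `x_{i+1}`, and `s_0` acts
by the reflection `(x_1, …, x_n) ↦ (x_n + 1, x_2, …, x_{n-1}, x_1 - 1)`. -/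
noncomputable def act {n : ℕ} [NeZero n] (ω : Equiv.Perm ℤ) (x : Fin n → ℝ) : Fin n → ℝ :=
  fun i => extCoord x (ω⁻¹ ((i : ℤ) + 1))

/-- The alcove `ω(A₀)` labelled by the affine permutation `ω`. -/
noncomputable def alcoveOf (n : ℕ) [NeZero n] (ω : Equiv.Perm ℤ) : Set (Fin n → ℝ) :=
  act ω '' fundamentalAlcove n

/-- The number of hyperplanes of the affine braid arrangement that separate `A` from the
fundamental alcove. -/
noncomputable def separationCount {n : ℕ} (A : Set (Fin n → ℝ)) : ℕ :=
  Set.ncard {p : Fin n × Fin n × ℤ | p.1 < p.2.1 ∧ A ⊆ farSide p.1 p.2.1 p.2.2}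

/-- `A` is a maximal alcove of `R`: an alcove in `R` which is separated from the fundamental alcove
by the greatest number of hyperplanes of the affine braid arrangement. -/
def IsMaximalAlcove {n : ℕ} (A R : Set (Fin n → ℝ)) : Prop :=
  A ∈ alcoves n ∧ A ⊆ R ∧
    ∀ B ∈ alcoves n, B ⊆ R → separationCount B ≤ separationCount A

/-- The bounded `k`-Shi region whose maximal alcove is `ω(A₀)`.  There is at most one such region,
since regions are pairwise disjoint; the value is `∅`, which is not a region, if there is none. -/
noncomputable def balc (n k : ℕ) [NeZero n] (ω : Equiv.Perm ℤ) : Set (Fin n → ℝ) :=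
  ⋃₀ {R | R ∈ boundedShiRegions n k ∧ IsMaximalAlcove (alcoveOf n ω) R}

/-! Everything is read off from the relative order of the extended coordinates of a vector. On `A₀`
they decrease along `ℤ`, and on `ω(A₀)` they decrease along the sequence `ω z`. The hyperplane
`H_{ij}^l` compares the indices `i + 1` and `j + 1 - l n`. It is in the `k`-Shi arrangement iff
these differ by less than `k n`, and it separates a point from `A₀` iff the two coordinates are
inverted.

Regions. For `m = k n - 1` one has `ω (z + 1 + m) = ω z + k n`, so stability means `ω (z + 1) - ω z
< k n` (`mem_stablePerms_iff`): no wall of `ω(A₀)` outside the Shi arrangement can be crossed away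
from `A₀`. This local maximality is global, because the noninversions of `ω` between values at
distance less than `k n` imply all others (`lt_of_step_lt`), and so they hold on the whole region.
Hence `ω(A₀)` is maximal, the region is bounded, and it determines `ω`. Conversely, an alcove of a
bounded region with the largest separation count is stable, since otherwise crossing a wall would
increase the count.

Labels. Let `T` be the set of values `b > a` that `ω` lists before `a`. The Pak–Stanley label of `a`
is the size of `T \ (T + k n)`, the value of `PS` is the size of `T \ (T - k n)`, and these sizes
agree.

Bijectivity of `PS`, for any `m > 0` coprime to `n`. For each `α`, sort the least elements of the
residue classes modulo `m` in `{p | α ≤ ω p}`. Passing to `α + 1` adds `m` to the entry `ω⁻¹ α`,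
whose index is `PS_ω(α)`. Stable permutations thus become periodic sorting processes
(`IsTrackSystem`) driven by their labels. The sums of the `j` smallest entries give the parking
inequalities. Two processes with the same labels cannot move apart, and by periodicity and
rearrangement they differ by a constant. For surjectivity, a real sorting process driven by a
parking function is nonexpansive. The parking inequalities bound the fixed points of its damped
versions, so by compactness it has a fixed point, which coprimality makes integral up to a common
shift. -/

/-! ### Quasi-periodic maps and affine permutations. -/

theorem map_add_mul_of_map_add {R : Type*} [CommRing R] {n : ℕ} {g : ℤ → R} {c : R}
    (h : ∀ x, g (x + n) = g x + c) (x q : ℤ) : g (x + q * n) = g x + q * c := by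
  induction q with
  | zero => simp
  | succ q ih =>
    have := h (x + q * n)
    rw [ih] at this
    rw [show x + ((q : ℤ) + 1) * n = x + q * n + n by ring, this]
    push_cast; ring
  | pred q ih =>
    have := h (x + (-(q : ℤ) - 1) * n)
    rw [show x + (-(q : ℤ) - 1) * n + n = x + -(q : ℤ) * n by ring, ih] at this
    rw [eq_sub_of_add_eq this.symm]
    push_cast; ring

theorem exists_eq_fin_add_mul (n : ℕ) [NeZero n] (a : ℤ) :
    ∃ (i : Fin n) (q : ℤ), a = (i : ℤ) + 1 + q * n := by
  have hn : (0 : ℤ) < n := by exact_mod_cast Nat.pos_of_ne_zero (NeZero.ne n)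
  have h0 := Int.emod_nonneg (a - 1) hn.ne'
  have h1 := Int.emod_lt_of_pos (a - 1) hn
  refine ⟨⟨((a - 1) % n).toNat, by omega⟩, (a - 1) / n, ?_⟩
  have := Int.emod_add_mul_ediv (a - 1) n
  simp only [Int.toNat_of_nonneg h0]
  linarith

theorem fin_eq_of_dvd_sub {n : ℕ} {i j : Fin n} (h : (n : ℤ) ∣ (i : ℤ) - j) : i = j := by
  have hi := i.isLt
  have hj := j.isLt
  have := Int.eq_zero_of_abs_lt_dvd h (by rw [abs_lt]; constructor <;> omega)
  ext; omega

/-- An injective map commuting with the translation by `n` permutes the residues modulo `n`. -/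
theorem exists_perm_residue {n : ℕ} [NeZero n] {w : ℤ → ℤ} (hw : ∀ x, w (x + n) = w x + n)
    (hinj : Function.Injective w) :
    ∃ (ρ : Equiv.Perm (Fin n)) (q : Fin n → ℤ), ∀ i : Fin n,
      w ((i : ℤ) + 1) = (ρ i : ℤ) + 1 + q i * n := by
  choose ρ q h using fun i : Fin n => exists_eq_fin_add_mul n (w ((i : ℤ) + 1))
  have hρ : Function.Injective ρ := by
    intro i j hij
    have h1 := map_add_mul_of_map_add hw ((j : ℤ) + 1) (q i - q j)
    have h2 : w ((i : ℤ) + 1) = w ((j : ℤ) + 1 + (q i - q j) * n) := by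
      rw [h1, h i, h j, hij]; push_cast; ring
    apply fin_eq_of_dvd_sub
    exact ⟨q i - q j, by linarith [hinj h2]⟩
  exact ⟨Equiv.ofBijective ρ (Finite.injective_iff_bijective.mp hρ), q, h⟩

theorem bijective_of_injective_of_map_add {n : ℕ} [NeZero n] {w : ℤ → ℤ}
    (hw : ∀ x, w (x + n) = w x + n) (hinj : Function.Injective w) : Function.Bijective w := by
  refine ⟨hinj, fun b => ?_⟩
  obtain ⟨ρ, q, h⟩ := exists_perm_residue hw hinj
  obtain ⟨j, r, rfl⟩ := exists_eq_fin_add_mul n b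
  refine ⟨((ρ.symm j : Fin n) : ℤ) + 1 + (r - q (ρ.symm j)) * n, ?_⟩
  rw [map_add_mul_of_map_add hw, h]
  simp only [Equiv.apply_symm_apply]
  push_cast; ring

theorem sum_comp_of_periodic {M : Type*} [AddCommGroup M] {n : ℕ} [NeZero n] {w : ℤ → ℤ}
    (hw : ∀ x, w (x + n) = w x + n) (hinj : Function.Injective w) {h : ℤ → M}
    (hh : ∀ x, h (x + n) = h x) :
    ∑ i : Fin n, h (w ((i : ℤ) + 1)) = ∑ i : Fin n, h ((i : ℤ) + 1) := by
  obtain ⟨ρ, q, hρ⟩ := exists_perm_residue hw hinj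
  have hp : Function.Periodic h (n : ℤ) := hh
  rw [← Equiv.sum_comp ρ fun i : Fin n => h ((i : ℤ) + 1)]
  refine Finset.sum_congr rfl fun i _ => ?_
  rw [hρ i]
  simpa using hp.int_mul (q i) ((ρ i : ℤ) + 1)

theorem sum_Icc_eq_sum_fin (n : ℕ) (g : ℤ → ℤ) :
    ∑ i ∈ Finset.Icc (1 : ℤ) n, g i = ∑ i : Fin n, g ((i : ℤ) + 1) := by
  symm
  refine Finset.sum_bij (fun (i : Fin n) _ => (i : ℤ) + 1) ?_ ?_ ?_ ?_
  · intro i _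
    have := i.isLt
    simp only [Finset.mem_Icc]; omega
  · intro i _ j _ h
    ext; omega
  · intro b hb
    simp only [Finset.mem_Icc] at hb
    exact ⟨⟨(b - 1).toNat, by omega⟩, Finset.mem_univ _, by simp; omega⟩
  · intro i _; rfl

theorem two_mul_sum_fin_succ (n : ℕ) : 2 * ∑ i : Fin n, ((i : ℤ) + 1) = n * (n + 1) := by
  rw [Fin.sum_univ_eq_sum_range (fun i => (i : ℤ) + 1)]
  induction n with
  | zero => simp
  | succ n ih => rw [Finset.sum_range_succ, mul_add, ih]; push_cast; ring

theorem mem_affinePerms_iff {n : ℕ} {ω : Equiv.Perm ℤ} :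
    ω ∈ affinePerms n ↔ (∀ x, ω (x + n) = ω x + n) ∧
      ∑ i : Fin n, ω ((i : ℤ) + 1) = ∑ i : Fin n, ((i : ℤ) + 1) := by
  have h := two_mul_sum_fin_succ n
  simp only [affinePerms, Set.mem_ofPred_eq, sum_Icc_eq_sum_fin]
  refine and_congr_right fun _ => ⟨fun h' => by linarith, fun h' => by linarith⟩

theorem inv_map_add {n : ℕ} {ω : Equiv.Perm ℤ} (h : ∀ x, ω (x + n) = ω x + n) (x : ℤ) :
    ω⁻¹ (x + n) = ω⁻¹ x + n := by
  rw [Equiv.Perm.inv_eq_iff_eq, h]; simp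

/-- The sum over a period of a quasi-periodic function is not changed by affine permutations. -/
theorem sum_comp_of_mem_affinePerms {n : ℕ} [NeZero n] {ω : Equiv.Perm ℤ}
    (hω : ω ∈ affinePerms n) {g : ℤ → ℝ} {c : ℝ} (hg : ∀ x, g (x + n) = g x + c) :
    ∑ i : Fin n, g (ω ((i : ℤ) + 1)) = ∑ i : Fin n, g ((i : ℤ) + 1) := by
  obtain ⟨h1, h2⟩ := mem_affinePerms_iff.mp hω
  have hn : (n : ℝ) ≠ 0 := by exact_mod_cast NeZero.ne n
  -- Subtracting the linear part makes `n g` periodic; the linear part itself has the prescribed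
  -- sum.
  have := sum_comp_of_periodic h1 ω.injective (h := fun x => (n : ℝ) * g x - c * x)
    (fun x => by rw [hg]; push_cast; ring)
  simp only [Finset.sum_sub_distrib, ← Finset.mul_sum] at this
  have h3 : ∑ i : Fin n, ((ω ((i : ℤ) + 1) : ℤ) : ℝ) = ∑ i : Fin n, (((i : ℤ) + 1 : ℤ) : ℝ) := by
    exact_mod_cast h2
  rw [h3] at this
  exact mul_left_cancel₀ hn (by linarith)

theorem inv_mem_affinePerms {n : ℕ} [NeZero n] {ω : Equiv.Perm ℤ} (hω : ω ∈ affinePerms n) :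
    ω⁻¹ ∈ affinePerms n := by
  have h1 := (mem_affinePerms_iff.mp hω).1
  have h := sum_comp_of_mem_affinePerms hω (g := fun x => ((ω⁻¹ x : ℤ) : ℝ)) (c := n)
    (fun x => by rw [inv_map_add h1]; push_cast; ring)
  simp only [Equiv.Perm.inv_def, Equiv.symm_apply_apply] at h
  refine mem_affinePerms_iff.mpr ⟨inv_map_add h1, ?_⟩
  exact_mod_cast h.symm

/-- Affine permutations that induce the same order on the values are equal. -/
theorem affinePerms_eq_of_order {n : ℕ} [NeZero n] {ω ω' : Equiv.Perm ℤ}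
    (hω : ω ∈ affinePerms n) (hω' : ω' ∈ affinePerms n)
    (h : ∀ a b, ω⁻¹ a < ω⁻¹ b → ω'⁻¹ a < ω'⁻¹ b) : ω = ω' := by
  have h1 := (mem_affinePerms_iff.mp hω).1
  have h1' := inv_map_add (mem_affinePerms_iff.mp hω').1
  -- The map `ω'⁻¹ ∘ ω` is strictly increasing, so its displacement is weakly increasing. Being
  -- periodic, the displacement is constant, and the normalization of the sums makes it zero.
  have hmono : ∀ z, ω'⁻¹ (ω z) - z ≤ ω'⁻¹ (ω (z + 1)) - (z + 1) := fun z => by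
    have := h (ω z) (ω (z + 1)) (by simp)
    omega
  have hM : Monotone fun z => ω'⁻¹ (ω z) - z := monotone_int_of_le_succ hmono
  have hn : (1 : ℤ) ≤ n := by exact_mod_cast Nat.one_le_iff_ne_zero.mpr (NeZero.ne n)
  have hstep : ∀ z, ω'⁻¹ (ω (z + 1)) - (z + 1) = ω'⁻¹ (ω z) - z := fun z => by
    apply le_antisymm _ (hmono z)
    have h2 := hM (show z + 1 ≤ z + n by omega)
    simp only [h1, h1'] at h2
    linarith
  have hc : ∀ z, ω'⁻¹ (ω z) = z + ω'⁻¹ (ω 0) := fun z => by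
    induction z with
    | zero => simp
    | succ z ih => have := hstep z; omega
    | pred z ih => have := hstep (-(z : ℤ) - 1); rw [sub_add_cancel] at this; omega
  have hs := sum_comp_of_mem_affinePerms hω (g := fun x => ((ω'⁻¹ x : ℤ) : ℝ)) (c := n)
    (fun x => by rw [h1']; push_cast; ring)
  have hs' : ∑ i : Fin n, (ω'⁻¹ (ω ((i : ℤ) + 1))) = ∑ i : Fin n, ω'⁻¹ ((i : ℤ) + 1) := by
    exact_mod_cast hs
  rw [(mem_affinePerms_iff.mp (inv_mem_affinePerms hω')).2] at hs'
  rw [Finset.sum_congr rfl fun i _ => hc _] at hs'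
  simp only [Finset.sum_add_distrib, Finset.sum_const, Finset.card_univ, Fintype.card_fin,
    nsmul_eq_mul] at hs'
  have h0 : ω'⁻¹ (ω 0) = 0 := by
    rcases mul_eq_zero.mp (show (n : ℤ) * ω'⁻¹ (ω 0) = 0 by linarith) with h | h
    · omega
    · exact h
  ext z
  have := hc z
  rw [h0, add_zero, Equiv.Perm.inv_eq_iff_eq] at this
  rw [this]

/-! ### Extended coordinates and the action. -/

theorem extCoord_fin_add {n : ℕ} [NeZero n] (x : Fin n → ℝ) (i : Fin n) (q : ℤ) :
    extCoord x ((i : ℤ) + 1 + q * n) = x i - q := by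
  have h := map_add_mul_of_map_add (g := extCoord x) (c := -1)
    (fun j => by rw [extCoord_add]; ring) ((i : ℤ) + 1) q
  rw [h, extCoord_coe]; ring

theorem extCoord_add_mul {n : ℕ} [NeZero n] (x : Fin n → ℝ) (a q : ℤ) :
    extCoord x (a + q * n) = extCoord x a - q := by
  have h := map_add_mul_of_map_add (g := extCoord x) (c := -1)
    (fun j => by rw [extCoord_add]; ring) a q
  rw [h]; ring

theorem extCoord_act {n : ℕ} [NeZero n] {ω : Equiv.Perm ℤ} (h : ∀ x, ω (x + n) = ω x + n)
    (y : Fin n → ℝ) (a : ℤ) : extCoord (act ω y) a = extCoord y (ω⁻¹ a) := by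
  obtain ⟨i, q, rfl⟩ := exists_eq_fin_add_mul n a
  rw [extCoord_fin_add, map_add_mul_of_map_add (inv_map_add h), extCoord_add_mul]
  rfl

theorem act_mem_sumZero {n : ℕ} [NeZero n] {ω : Equiv.Perm ℤ} (h : ω ∈ affinePerms n)
    {y : Fin n → ℝ} (hy : y ∈ sumZero n) : act ω y ∈ sumZero n := by
  have := sum_comp_of_mem_affinePerms (inv_mem_affinePerms h) (g := extCoord y) (c := -1)
    (fun j => by rw [extCoord_add]; ring)
  simp only [extCoord_coe] at this
  exact this.trans hy

theorem coord_sub_sub_eq {n : ℕ} [NeZero n] (x : Fin n → ℝ) (i j : Fin n) (l : ℤ) :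
    x i - x j - l = extCoord x ((i : ℤ) + 1) - extCoord x ((j : ℤ) + 1 + (-l) * n) := by
  rw [extCoord_fin_add, extCoord_coe]; push_cast; ring

/-- Up to a translation by a multiple of `n`, two integers which are not congruent modulo `n` are
`i + 1` and `j + 1 - l n` for a hyperplane `H_{ij}^l`. -/
theorem exists_pair_eq (n : ℕ) [NeZero n] {a b : ℤ} (h : ¬ (n : ℤ) ∣ b - a) :
    ∃ (i j : Fin n) (l t : ℤ), i < j ∧
      ((a = (i : ℤ) + 1 + t * n ∧ b = (j : ℤ) + 1 + (-l) * n + t * n) ∨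
        (b = (i : ℤ) + 1 + t * n ∧ a = (j : ℤ) + 1 + (-l) * n + t * n)) := by
  obtain ⟨i, q, rfl⟩ := exists_eq_fin_add_mul n a
  obtain ⟨j, r, rfl⟩ := exists_eq_fin_add_mul n b
  rcases lt_trichotomy i j with hij | rfl | hij
  · exact ⟨i, j, q - r, q, hij, .inl ⟨rfl, by ring⟩⟩
  · exact absurd ⟨r - q, by ring⟩ h
  · exact ⟨j, i, r - q, r, hij, .inr ⟨rfl, by ring⟩⟩

/-! ### Arrangements and the order of extended coordinates. -/

/-- The hyperplanes `H_{ij}^l` for which `Q` holds for `(j - l n) - i`. -/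
def differenceArrangement (n : ℕ) (Q : ℤ → Prop) : Set (Set (Fin n → ℝ)) :=
  {H | ∃ (i j : Fin n) (l : ℤ), i < j ∧ Q ((j : ℤ) - i - l * n) ∧ H = hyperplane i j l}

theorem affineBraid_eq (n : ℕ) : affineBraid n = differenceArrangement n fun _ => True := by
  simp [affineBraid, differenceArrangement]

/-- Since `0 < j - i < n`, the lopsided range of levels in the Shi arrangement is a symmetric
condition on the distance of the compared indices. -/
theorem abs_sub_mul_lt_iff {n : ℕ} {k : ℤ} {i j : Fin n} (hij : i < j) (l : ℤ) :
    |(j : ℤ) - i - l * n| < k * n ↔ -k < l ∧ l ≤ k := by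
  have hj := j.isLt
  have hij' : (i : ℤ) < j := by exact_mod_cast hij
  have hn : (0 : ℤ) < n := by omega
  have hjn : (j : ℤ) < n := by exact_mod_cast hj
  rw [abs_lt]
  constructor
  · rintro ⟨h1, h2⟩
    constructor
    · by_contra! h
      have := mul_le_mul_of_nonneg_right h hn.le
      linarith
    · by_contra! h
      have := mul_le_mul_of_nonneg_right (Int.add_one_le_of_lt h) hn.le
      have hi : (0 : ℤ) ≤ i := by positivity
      linarith
  · rintro ⟨h1, h2⟩
    have e1 := mul_le_mul_of_nonneg_right h2 hn.le
    have e2 := mul_le_mul_of_nonneg_right (Int.add_one_le_of_lt h1) hn.le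
    have hi : (0 : ℤ) ≤ i := by positivity
    constructor <;> linarith

theorem shiArrangement_eq (n k : ℕ) :
    shiArrangement n k = differenceArrangement n fun d => |d| < (k : ℤ) * n := by
  ext H
  simp only [shiArrangement, differenceArrangement, Set.mem_ofPred_eq]
  refine exists_congr fun i => exists_congr fun j => exists_congr fun l => and_congr_right fun h => ?_
  rw [abs_sub_mul_lt_iff h, and_assoc]

theorem mem_compl_differenceArrangement {n : ℕ} [NeZero n] {Q : ℤ → Prop}
    (hQ : ∀ d, Q d → Q (-d)) {x : Fin n → ℝ} :
    x ∈ sumZero n \ ⋃₀ differenceArrangement n Q ↔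
      x ∈ sumZero n ∧ ∀ a b, a ≠ b → Q (b - a) → extCoord x a ≠ extCoord x b := by
  refine and_congr_right fun hx => ?_
  constructor
  · intro h a b hab hq he
    by_cases hd : (n : ℤ) ∣ b - a
    · obtain ⟨q, hq⟩ := hd
      obtain rfl : b = a + q * n := by linarith
      rw [extCoord_add_mul] at he
      have : (q : ℝ) = 0 := by linarith
      have : q = 0 := by exact_mod_cast this
      simp [this] at hab
    · obtain ⟨i, j, l, t, hij, ⟨rfl, rfl⟩ | ⟨rfl, rfl⟩⟩ := exists_pair_eq n hd
      · refine h ⟨_, ⟨i, j, l, hij, ?_, rfl⟩, hx, ?_⟩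
        · convert hq using 1; ring
        · simp only [extCoord_add_mul _ _ t] at he
          have := coord_sub_sub_eq x i j l
          linarith
      · refine h ⟨_, ⟨i, j, l, hij, ?_, rfl⟩, hx, ?_⟩
        · convert hQ _ hq using 1; ring
        · simp only [extCoord_add_mul _ _ t] at he
          have := coord_sub_sub_eq x i j l
          linarith
  · rintro h ⟨_, ⟨i, j, l, hij, hq, rfl⟩, -, he⟩
    have := coord_sub_sub_eq x i j l
    refine h ((i : ℤ) + 1) ((j : ℤ) + 1 + (-l) * n) ?_ ?_ (by linarith)
    · intro he'
      exact hij.ne (fin_eq_of_dvd_sub ⟨-l, by linarith⟩)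
    · convert hq using 1; ring

/-- By the intermediate value theorem no sign changes on a component. Conversely, the vectors with
given signs form a convex set. -/
theorem connectedComponentIn_compl_eq {n : ℕ} {Q : ℤ → Prop} {x : Fin n → ℝ}
    (hx : x ∈ sumZero n \ ⋃₀ differenceArrangement n Q) :
    connectedComponentIn (sumZero n \ ⋃₀ differenceArrangement n Q) x =
      {y | y ∈ sumZero n ∧ ∀ (i j : Fin n) (l : ℤ), i < j → Q ((j : ℤ) - i - l * n) →
        0 < (x i - x j - l) * (y i - y j - l)} := by
  have hne : ∀ y ∈ sumZero n \ ⋃₀ differenceArrangement n Q, ∀ (i j : Fin n) (l : ℤ), i < j →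
      Q ((j : ℤ) - i - l * n) → y i - y j - l ≠ 0 := by
    intro y hy i j l hij hq h0
    exact hy.2 ⟨_, ⟨i, j, l, hij, hq, rfl⟩, hy.1, by linarith⟩
  apply Set.Subset.antisymm
  · intro y hy
    have hsub := connectedComponentIn_subset (sumZero n \ ⋃₀ differenceArrangement n Q) x
    refine ⟨(hsub hy).1, fun i j l hij hq => ?_⟩
    have hpre : IsPreconnected ((fun z : Fin n → ℝ => (x i - x j - l) * (z i - z j - l)) ''
        connectedComponentIn (sumZero n \ ⋃₀ differenceArrangement n Q) x) :=
      isPreconnected_connectedComponentIn.image _ (by fun_prop)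
    by_contra! hle
    have h0 := hpre.ordConnected.out ⟨y, hy, rfl⟩ ⟨x, mem_connectedComponentIn hx, rfl⟩
      (show (0 : ℝ) ∈ _ from ⟨hle, mul_self_nonneg _⟩)
    obtain ⟨z, hz, hz0⟩ := h0
    rcases mul_eq_zero.mp hz0 with h | h
    · exact hne x hx i j l hij hq h
    · exact hne z (hsub hz) i j l hij hq h
  · apply IsPreconnected.subset_connectedComponentIn
    · apply Convex.isPreconnected
      intro y hy z hz s t hs ht hst
      refine ⟨?_, fun i j l hij hq => ?_⟩
      · have h1 : ∑ i, y i = 0 := hy.1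
        have h2 : ∑ i, z i = 0 := hz.1
        simp [sumZero, Finset.sum_add_distrib, ← Finset.mul_sum, h1, h2]
      · have h1 := hy.2 i j l hij hq
        have h2 := hz.2 i j l hij hq
        have : (x i - x j - l) * ((s • y + t • z) i - (s • y + t • z) j - l) =
            s * ((x i - x j - l) * (y i - y j - l)) + t * ((x i - x j - l) * (z i - z j - l)) := by
          simp only [Pi.add_apply, Pi.smul_apply, smul_eq_mul]
          linear_combination (x i - x j - l) * l * hst
        rw [this]
        rcases hs.eq_or_lt with rfl | hs
        · have : t = 1 := by linarith
          subst this; linarith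
        · have := mul_pos hs h1
          have := mul_nonneg ht h2.le
          linarith
    · exact ⟨hx.1, fun i j l hij hq => mul_self_pos.mpr (hne x hx i j l hij hq)⟩
    · rintro y ⟨hy, h⟩
      refine ⟨hy, ?_⟩
      rintro ⟨_, ⟨i, j, l, hij, hq, rfl⟩, -, he⟩
      have := h i j l hij hq
      rw [he, sub_self, mul_zero] at this
      exact lt_irrefl _ this

/-- A region consists of the vectors whose extended coordinates are in the same relative order. -/
theorem connectedComponentIn_compl_eq_order {n : ℕ} [NeZero n] {Q : ℤ → Prop}
    (hQ : ∀ d, Q d → Q (-d)) {x : Fin n → ℝ}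
    (hx : x ∈ sumZero n \ ⋃₀ differenceArrangement n Q) :
    connectedComponentIn (sumZero n \ ⋃₀ differenceArrangement n Q) x =
      {y | y ∈ sumZero n ∧ ∀ a b, Q (b - a) → extCoord x a < extCoord x b →
        extCoord y a < extCoord y b} := by
  rw [connectedComponentIn_compl_eq hx]
  ext y
  refine and_congr_right fun hy => ?_
  constructor
  · intro h a b hq hlt
    by_cases hd : (n : ℤ) ∣ b - a
    · obtain ⟨q, hq⟩ := hd
      obtain rfl : b = a + q * n := by linarith
      rw [extCoord_add_mul] at hlt ⊢
      linarith
    · obtain ⟨i, j, l, t, hij, ⟨rfl, rfl⟩ | ⟨rfl, rfl⟩⟩ := exists_pair_eq n hd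
      · have hp := h i j l hij (by convert hq using 1; ring)
        rw [coord_sub_sub_eq x, coord_sub_sub_eq y] at hp
        simp only [extCoord_add_mul _ _ t] at hlt ⊢
        have := neg_of_mul_pos_right hp (by linarith)
        linarith
      · have hp := h i j l hij (by convert hQ _ hq using 1; ring)
        rw [coord_sub_sub_eq x, coord_sub_sub_eq y] at hp
        simp only [extCoord_add_mul _ _ t] at hlt ⊢
        have := pos_of_mul_pos_right hp (by linarith)
        linarith
  · intro h i j l hij hq
    rw [coord_sub_sub_eq x, coord_sub_sub_eq y]
    have hne := ((mem_compl_differenceArrangement hQ).mp hx).2 ((i : ℤ) + 1)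
      ((j : ℤ) + 1 + (-l) * n) (fun he => hij.ne (fin_eq_of_dvd_sub ⟨-l, by linarith⟩))
      (by convert hq using 1; ring)
    rcases hne.lt_or_gt with hlt | hlt
    · have := h _ _ (by convert hq using 1; ring) hlt
      exact mul_pos_of_neg_of_neg (by linarith) (by linarith)
    · have := h _ _ (by convert hQ _ hq using 1; ring) hlt
      exact mul_pos (by linarith) (by linarith)

/-! ### Alcoves and affine permutations. -/

theorem mem_fundamentalAlcove_iff {n : ℕ} [NeZero n] {y : Fin n → ℝ} :
    y ∈ fundamentalAlcove n ↔ y ∈ sumZero n ∧ StrictAnti (extCoord y) := by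
  refine and_congr_right fun _ => ⟨?_, ?_⟩
  · rintro ⟨h1, h2⟩ a b hab
    obtain ⟨i, q, rfl⟩ := exists_eq_fin_add_mul n a
    obtain ⟨j, r, rfl⟩ := exists_eq_fin_add_mul n b
    rw [extCoord_fin_add, extCoord_fin_add]
    have hi := i.isLt
    have hj := j.isLt
    have hn : (0 : ℤ) < n := by omega
    have hi' : (i : ℤ) < n := by exact_mod_cast hi
    have hj' : (j : ℤ) < n := by exact_mod_cast hj
    have hqr : q ≤ r := by
      by_contra! h
      have := mul_le_mul_of_nonneg_right (Int.add_one_le_of_lt h) hn.le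
      have hi : (0 : ℤ) ≤ i := by positivity
      linarith
    rcases hqr.eq_or_lt with rfl | hqr
    · have : y j < y i := h1 (Fin.lt_def.mpr (by omega))
      linarith
    · have := h2 j i
      have : (q : ℝ) + 1 ≤ r := by exact_mod_cast hqr
      linarith
  · intro h
    refine ⟨fun i j hij => ?_, fun i j => ?_⟩
    · have := h (show (i : ℤ) + 1 < (j : ℤ) + 1 by have := Fin.lt_def.mp hij; omega)
      simpa only [extCoord_coe] using this
    · have hi := i.isLt
      have hj := j.isLt
      have := h (show (j : ℤ) + 1 < (i : ℤ) + 1 + n by omega)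
      simpa only [extCoord_coe, extCoord_add] using this

theorem fundamentalAlcove_nonempty (n : ℕ) [NeZero n] : (fundamentalAlcove n).Nonempty := by
  have hn : (0 : ℝ) < n := by exact_mod_cast Nat.pos_of_ne_zero (NeZero.ne n)
  have hsum : 2 * ∑ i : Fin n, ((i : ℝ) + 1) = n * (n + 1) := by
    exact_mod_cast two_mul_sum_fin_succ n
  refine ⟨fun i => (((n : ℝ) + 1) / 2 - ((i : ℝ) + 1)) / n, ?_, fun i j hij => ?_, fun i j => ?_⟩
  · change ∑ i : Fin n, (((n : ℝ) + 1) / 2 - ((i : ℝ) + 1)) / n = 0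
    rw [← Finset.sum_div, Finset.sum_sub_distrib]
    simp only [Finset.sum_const, Finset.card_univ, Fintype.card_fin, nsmul_eq_mul]
    rw [div_eq_zero_iff]; left; linarith
  · have : (i : ℝ) < j := by exact_mod_cast hij
    change _ / _ < _ / _
    gcongr
  · rw [sub_lt_iff_lt_add, div_add_one hn.ne']
    have : (j : ℝ) < n := by exact_mod_cast j.isLt
    have : (0 : ℝ) ≤ i := by positivity
    refine div_lt_div_of_pos_right ?_ hn
    linarith

/-- The action permutes extended coordinates, so it carries the decreasing order that defines `A₀`
to the order in which `ω` lists the integers. -/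
theorem mem_alcoveOf_iff {n : ℕ} [NeZero n] {ω : Equiv.Perm ℤ} (hω : ω ∈ affinePerms n)
    {x : Fin n → ℝ} : x ∈ alcoveOf n ω ↔
      x ∈ sumZero n ∧ ∀ a b, ω⁻¹ a < ω⁻¹ b → extCoord x b < extCoord x a := by
  have h1 := (mem_affinePerms_iff.mp hω).1
  constructor
  · rintro ⟨y, hy, rfl⟩
    rw [mem_fundamentalAlcove_iff] at hy
    refine ⟨act_mem_sumZero hω hy.1, fun a b hab => ?_⟩
    rw [extCoord_act h1, extCoord_act h1]
    exact hy.2 hab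
  · rintro ⟨hx, h⟩
    have h1' := inv_map_add h1
    refine ⟨act ω⁻¹ x, ?_, ?_⟩
    · rw [mem_fundamentalAlcove_iff]
      refine ⟨act_mem_sumZero (inv_mem_affinePerms hω) hx, fun a b hab => ?_⟩
      rw [extCoord_act h1', extCoord_act h1', inv_inv]
      exact h _ _ (by simpa using hab)
    · ext i
      rw [← extCoord_coe (act ω _), extCoord_act h1, extCoord_act h1', ← extCoord_coe x]
      simp

theorem alcoveOf_nonempty (n : ℕ) [NeZero n] (ω : Equiv.Perm ℤ) : (alcoveOf n ω).Nonempty :=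
  (fundamentalAlcove_nonempty n).image _

theorem lt_iff_of_mem_alcoveOf {n : ℕ} [NeZero n] {ω : Equiv.Perm ℤ} (hω : ω ∈ affinePerms n)
    {x : Fin n → ℝ} (hx : x ∈ alcoveOf n ω) (a b : ℤ) :
    extCoord x b < extCoord x a ↔ ω⁻¹ a < ω⁻¹ b := by
  have h := ((mem_alcoveOf_iff hω).mp hx).2
  refine ⟨fun hlt => ?_, h a b⟩
  rcases lt_trichotomy (ω⁻¹ a) (ω⁻¹ b) with h1 | h1 | h1
  · exact h1
  · rw [ω⁻¹.injective h1] at hlt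
    exact absurd hlt (lt_irrefl _)
  · exact absurd hlt (h b a h1).asymm

theorem ceil_add_ceil_neg {t : ℝ} (h : ∀ l : ℤ, t ≠ l) : ⌈t⌉ + ⌈-t⌉ = 1 := by
  have : ⌈t⌉ = ⌊t⌋ + 1 := by
    rw [Int.ceil_eq_iff]
    have := (Int.floor_le t).lt_of_ne (h _).symm
    have := Int.lt_floor_add_one t
    push_cast
    constructor <;> linarith
  rw [Int.ceil_neg, this]; ring

/-- Every point off the affine braid arrangement lies in an alcove `ω(A₀)`. -/
theorem exists_mem_alcoveOf {n : ℕ} [NeZero n] {x : Fin n → ℝ} (hx : x ∈ sumZero n)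
    (hinj : Function.Injective (extCoord x)) : ∃ ω ∈ affinePerms n, x ∈ alcoveOf n ω := by
  -- The position of `a` when the indices are listed by decreasing extended coordinate: `⌈x c -
  -- extCoord x a⌉` counts the `q ≥ 0` with `x c - q > extCoord x a`, or, if negative, minus the `q
  -- < 0` that fail this. The sum over a period is right because `⌈t⌉ + ⌈-t⌉ = 1` for nonintegral
  -- `t`.
  set u : ℤ → ℤ := fun a => 1 + ∑ c, ⌈x c - extCoord x a⌉ with hu
  have hadd : ∀ a, u (a + n) = u a + n := fun a => by
    have : ∀ c, ⌈x c - extCoord x (a + n)⌉ = ⌈x c - extCoord x a⌉ + 1 := fun c => by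
      rw [extCoord_add, ← Int.ceil_add_one]; congr 1; ring
    simp only [hu, this, Finset.sum_add_distrib]
    simp; ring
  have hlt : ∀ a b, extCoord x b < extCoord x a → u a < u b := fun a b hab => by
    obtain ⟨i, q, rfl⟩ := exists_eq_fin_add_mul n a
    refine (add_lt_add_iff_left 1).mpr (Finset.sum_lt_sum (fun c _ => ?_) ⟨i, Finset.mem_univ _, ?_⟩)
    · exact Int.ceil_le_ceil (by linarith)
    · rw [extCoord_fin_add] at hab ⊢
      rw [sub_sub_cancel, Int.ceil_intCast, Int.lt_ceil]
      linarith
  have huinj : Function.Injective u := fun a b hab => by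
    by_contra hne
    rcases (hinj.ne hne).lt_or_gt with h | h
    · exact (hlt _ _ h).ne' hab
    · exact (hlt _ _ h).ne hab
  set U := Equiv.ofBijective u (bijective_of_injective_of_map_add hadd huinj)
  have hU : U ∈ affinePerms n := by
    refine mem_affinePerms_iff.mpr ⟨hadd, ?_⟩
    change ∑ i : Fin n, (1 + ∑ c, ⌈x c - extCoord x ((i : ℤ) + 1)⌉) = _
    have key : ∀ i c, ⌈x c - x i⌉ + ⌈x i - x c⌉ = if i = c then 0 else 1 := fun i c => by
      split_ifs with hic
      · simp [hic]
      · rw [← neg_sub (x c) (x i)]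
        refine ceil_add_ceil_neg fun l hl => hic ?_
        have := @hinj ((c : ℤ) + 1 + l * n) ((i : ℤ) + 1) (by
          rw [extCoord_fin_add, extCoord_coe]; linarith)
        exact fin_eq_of_dvd_sub ⟨l, by linarith⟩
    have h2 : ∑ i, ∑ c, ⌈x c - x i⌉ + ∑ i, ∑ c, ⌈x c - x i⌉ = (n : ℤ) * (n - 1) := by
      nth_rw 2 [Finset.sum_comm]
      simp only [← Finset.sum_add_distrib, key]
      have : ∀ i : Fin n, ∑ c, (if i = c then (0 : ℤ) else 1) = n - 1 := fun i => by
        rw [Finset.sum_congr rfl fun c _ =>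
          show (if i = c then (0 : ℤ) else 1) = 1 - if i = c then 1 else 0 by split_ifs <;> rfl]
        simp
      simp [this]; ring
    have h3 := two_mul_sum_fin_succ n
    simp only [extCoord_coe, Finset.sum_add_distrib (f := fun _ : Fin n => (1 : ℤ))]
    simp only [Finset.sum_const, Finset.card_univ, Fintype.card_fin, nsmul_eq_mul]
    linarith
  refine ⟨U⁻¹, inv_mem_affinePerms hU, ?_⟩
  rw [mem_alcoveOf_iff (inv_mem_affinePerms hU), inv_inv]
  refine ⟨hx, fun a b hab => ?_⟩
  by_contra! hle
  rcases hle.eq_or_lt with he | hl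
  · rw [hinj he] at hab
    exact lt_irrefl _ hab
  · exact (hlt _ _ hl).asymm hab

theorem injective_extCoord_of_mem_alcoveOf {n : ℕ} [NeZero n] {ω : Equiv.Perm ℤ}
    (hω : ω ∈ affinePerms n) {x : Fin n → ℝ} (hx : x ∈ alcoveOf n ω) :
    Function.Injective (extCoord x) := by
  intro a b hab
  by_contra hne
  have h := lt_iff_of_mem_alcoveOf hω hx
  rcases (ω⁻¹.injective.ne hne).lt_or_gt with hl | hl
  · exact ((h _ _).mpr hl).ne' hab
  · exact ((h _ _).mpr hl).ne hab

theorem mem_compl_of_injective {n : ℕ} [NeZero n] {Q : ℤ → Prop} (hQ : ∀ d, Q d → Q (-d))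
    {x : Fin n → ℝ} (hx : x ∈ sumZero n) (h : Function.Injective (extCoord x)) :
    x ∈ sumZero n \ ⋃₀ differenceArrangement n Q :=
  (mem_compl_differenceArrangement hQ).mpr ⟨hx, fun _ _ hab _ => h.ne hab⟩

theorem connectedComponentIn_affineBraid {n : ℕ} [NeZero n] {ω : Equiv.Perm ℤ}
    (hω : ω ∈ affinePerms n) {x : Fin n → ℝ} (hx : x ∈ alcoveOf n ω) :
    connectedComponentIn (sumZero n \ ⋃₀ affineBraid n) x = alcoveOf n ω := by
  have hinj := injective_extCoord_of_mem_alcoveOf hω hx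
  have hV := ((mem_alcoveOf_iff hω).mp hx).1
  rw [affineBraid_eq, connectedComponentIn_compl_eq_order (fun _ h => h)
    (mem_compl_of_injective (fun _ h => h) hV hinj)]
  ext y
  rw [mem_alcoveOf_iff hω]
  refine and_congr_right fun _ => ⟨fun h a b hab => ?_, fun h a b _ hab => ?_⟩
  · exact h _ _ trivial ((lt_iff_of_mem_alcoveOf hω hx _ _).mpr hab)
  · exact h _ _ ((lt_iff_of_mem_alcoveOf hω hx _ _).mp hab)

theorem alcoveOf_mem_alcoves {n : ℕ} [NeZero n] {ω : Equiv.Perm ℤ} (hω : ω ∈ affinePerms n) :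
    alcoveOf n ω ∈ alcoves n := by
  obtain ⟨x, hx⟩ := alcoveOf_nonempty n ω
  refine ⟨x, ?_, (connectedComponentIn_affineBraid hω hx).symm⟩
  rw [affineBraid_eq]
  exact mem_compl_of_injective (fun _ h => h) ((mem_alcoveOf_iff hω).mp hx).1
    (injective_extCoord_of_mem_alcoveOf hω hx)

theorem exists_eq_alcoveOf {n : ℕ} [NeZero n] {A : Set (Fin n → ℝ)} (hA : A ∈ alcoves n) :
    ∃ ω ∈ affinePerms n, A = alcoveOf n ω := by
  obtain ⟨x, hx, rfl⟩ := hA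
  have hx' := hx
  rw [affineBraid_eq, mem_compl_differenceArrangement fun _ h => h] at hx'
  obtain ⟨ω, hω, h⟩ := exists_mem_alcoveOf hx'.1 fun a b hab => by
    by_contra hne
    exact hx'.2 a b hne trivial hab
  exact ⟨ω, hω, connectedComponentIn_affineBraid hω h⟩

/-! ### Separation from the fundamental alcove. -/

theorem mem_farSide_iff {n : ℕ} [NeZero n] {i j : Fin n} (hij : i < j) (l : ℤ) {x : Fin n → ℝ} :
    x ∈ farSide i j l ↔ x ∈ sumZero n ∧
      ((l ≤ 0 ∧ x i - x j - l < 0) ∨ (0 < l ∧ 0 < x i - x j - l)) := by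
  refine and_congr_right fun _ => ?_
  have hA : ∀ y ∈ fundamentalAlcove n, (l ≤ 0 → 0 < y i - y j - l) ∧ (0 < l → y i - y j - l < 0) := by
    rintro y ⟨-, h1, h2⟩
    have := h1 hij
    have := h2 i j
    refine ⟨fun h => ?_, fun h => ?_⟩
    · have : (l : ℝ) ≤ 0 := by exact_mod_cast h
      linarith
    · have : (1 : ℝ) ≤ l := by exact_mod_cast h
      linarith
  constructor
  · intro h
    obtain ⟨y, hy⟩ := fundamentalAlcove_nonempty n
    have hp := h y hy
    rcases le_or_gt l 0 with hl | hl
    · exact .inl ⟨hl, by by_contra! h0; exact hp.not_ge (mul_nonneg h0 ((hA y hy).1 hl).le)⟩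
    · exact .inr ⟨hl, by
        by_contra! h0; exact hp.not_ge (mul_nonneg_of_nonpos_of_nonpos h0 ((hA y hy).2 hl).le)⟩
  · rintro (⟨hl, h⟩ | ⟨hl, h⟩) y hy
    · exact mul_neg_of_neg_of_pos h ((hA y hy).1 hl)
    · exact mul_neg_of_pos_of_neg h ((hA y hy).2 hl)

/-- The sign of the level tells which of the two compared indices is larger, and hence how their
coordinates are ordered on `A₀`. -/
theorem fin_pair_lt_iff {n : ℕ} {i j : Fin n} (hij : i < j) (l : ℤ) :
    ((i : ℤ) + 1 < (j : ℤ) + 1 + (-l) * n ↔ l ≤ 0) ∧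
      ((j : ℤ) + 1 + (-l) * n < (i : ℤ) + 1 ↔ 0 < l) := by
  have hj' : (j : ℤ) < n := by exact_mod_cast j.isLt
  have hij' : (i : ℤ) < j := by exact_mod_cast hij
  have hi : (0 : ℤ) ≤ i := by positivity
  have h1 : l ≤ 0 → (i : ℤ) + 1 < (j : ℤ) + 1 + (-l) * n := fun h => by
    have : 0 ≤ (-l) * n := mul_nonneg (by omega) (by omega)
    omega
  have h2 : 0 < l → (j : ℤ) + 1 + (-l) * n < (i : ℤ) + 1 := fun h => by
    have : 1 * (n : ℤ) ≤ l * n := mul_le_mul_of_nonneg_right (by omega) (by omega)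
    linarith
  refine ⟨⟨fun h => ?_, h1⟩, ⟨fun h => ?_, h2⟩⟩
  · by_contra! h'
    exact (h2 h').asymm h
  · by_contra! h'
    exact (h1 h').asymm h

/-- `x` is on the far side of a hyperplane iff the extended coordinates that the hyperplane
compares are in increasing order. -/
theorem mem_farSide_iff_extCoord {n : ℕ} [NeZero n] {i j : Fin n} (hij : i < j) (l : ℤ)
    {x : Fin n → ℝ} {a b : ℤ} (ha : a = (i : ℤ) + 1) (hb : b = (j : ℤ) + 1 + (-l) * n) :
    x ∈ farSide i j l ↔ x ∈ sumZero n ∧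
      ((a < b ∧ extCoord x a < extCoord x b) ∨ (b < a ∧ extCoord x b < extCoord x a)) := by
  rw [mem_farSide_iff hij, coord_sub_sub_eq, ← ha, ← hb]
  have := fin_pair_lt_iff hij l
  rw [← ha, ← hb] at this
  rw [this.1, this.2, sub_neg, sub_pos]

theorem connectedComponentIn_subset_farSide_iff {n : ℕ} [NeZero n] {Q : ℤ → Prop}
    (hQ : ∀ d, Q d → Q (-d)) {x : Fin n → ℝ}
    (hx : x ∈ sumZero n \ ⋃₀ differenceArrangement n Q) {i j : Fin n} (hij : i < j) {l : ℤ}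
    (hq : Q ((j : ℤ) - i - l * n)) :
    connectedComponentIn (sumZero n \ ⋃₀ differenceArrangement n Q) x ⊆ farSide i j l ↔
      x ∈ farSide i j l := by
  refine ⟨fun h => h (mem_connectedComponentIn hx), fun h y hy => ?_⟩
  rw [connectedComponentIn_compl_eq_order hQ hx] at hy
  rw [mem_farSide_iff_extCoord hij l rfl rfl] at h ⊢
  refine ⟨hy.1, h.2.imp (And.imp_right fun h => ?_) (And.imp_right fun h => ?_)⟩
  · exact hy.2 _ _ (by convert hq using 1; ring) h
  · exact hy.2 _ _ (by convert hQ _ hq using 1; ring) h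

/-- The hyperplanes of the affine braid arrangement that separate `x` from the fundamental
alcove. -/
def separatingSet {n : ℕ} (x : Fin n → ℝ) : Set (Fin n × Fin n × ℤ) :=
  {p | p.1 < p.2.1 ∧ x ∈ farSide p.1 p.2.1 p.2.2}

theorem separationCount_alcoveOf {n : ℕ} [NeZero n] {ω : Equiv.Perm ℤ}
    (hω : ω ∈ affinePerms n) {x : Fin n → ℝ} (hx : x ∈ alcoveOf n ω) :
    separationCount (alcoveOf n ω) = (separatingSet x).ncard := by
  have hQ : ∀ d : ℤ, (fun _ => True) d → (fun _ => True) (-d) := fun _ h => h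
  have hx' := mem_compl_of_injective hQ ((mem_alcoveOf_iff hω).mp hx).1
    (injective_extCoord_of_mem_alcoveOf hω hx)
  unfold separationCount separatingSet
  congr 1
  ext p
  refine and_congr_right fun hp => ?_
  rw [← connectedComponentIn_affineBraid hω hx, affineBraid_eq,
    connectedComponentIn_subset_farSide_iff hQ hx' hp trivial]

/-- Separating hyperplanes are inversions of the extended coordinates, so inclusion of inversions
gives inclusion of separating sets. -/
theorem separatingSet_subset {n : ℕ} [NeZero n] {x y : Fin n → ℝ} (hx : x ∈ sumZero n)
    (h : ∀ a b : ℤ, a < b → extCoord y a < extCoord y b → extCoord x a < extCoord x b) :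
    separatingSet y ⊆ separatingSet x := by
  rintro ⟨i, j, l⟩ ⟨hij, hf⟩
  refine ⟨hij, ?_⟩
  rw [mem_farSide_iff_extCoord hij l rfl rfl] at hf ⊢
  exact ⟨hx, hf.2.imp (fun h' => ⟨h'.1, h _ _ h'.1 h'.2⟩) (fun h' => ⟨h'.1, h _ _ h'.1 h'.2⟩)⟩

theorem separatingSet_subset_box {n : ℕ} [NeZero n] {x : Fin n → ℝ} {L : ℤ}
    (h : ∀ i j, x i - x j ≤ L) :
    separatingSet x ⊆ Set.univ ×ˢ Set.univ ×ˢ Set.Icc (-L) L := by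
  rintro ⟨i, j, l⟩ ⟨hij, hf⟩
  refine ⟨trivial, trivial, ?_⟩
  have h1 := h i j
  have h2 := h j i
  have hL : (0 : ℝ) ≤ L := by linarith
  have hL : 0 ≤ L := by exact_mod_cast hL
  rcases ((mem_farSide_iff hij l).mp hf).2 with ⟨hl, hlt⟩ | ⟨hl, hlt⟩
  · have : (-L : ℝ) ≤ l := by linarith
    exact ⟨by exact_mod_cast this, by dsimp only; omega⟩
  · have : (l : ℝ) ≤ L := by linarith
    exact ⟨by dsimp only; omega, by exact_mod_cast this⟩

theorem finite_box (n : ℕ) (L : ℤ) :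
    ((Set.univ : Set (Fin n)) ×ˢ (Set.univ : Set (Fin n)) ×ˢ Set.Icc (-L) L).Finite :=
  Set.finite_univ.prod (Set.finite_univ.prod (Set.finite_Icc _ _))

theorem finite_separatingSet {n : ℕ} [NeZero n] (x : Fin n → ℝ) : (separatingSet x).Finite := by
  obtain ⟨L, hL⟩ := exists_nat_ge (∑ p : Fin n × Fin n, |x p.1 - x p.2|)
  refine (finite_box n L).subset (separatingSet_subset_box fun i j => ?_)
  refine (le_abs_self _).trans ((Finset.single_le_sum (f := fun p : Fin n × Fin n =>
    |x p.1 - x p.2|) (fun _ _ => abs_nonneg _) (Finset.mem_univ (i, j))).trans ?_)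
  exact_mod_cast hL

/-! ### Stability as a bound on consecutive jumps. -/

theorem int_map_add_mul {n : ℕ} {w : ℤ → ℤ} (hw : ∀ x, w (x + n) = w x + n) (x q : ℤ) :
    w (x + q * n) = w x + q * n := by
  simpa using map_add_mul_of_map_add hw x q

theorem mem_stablePerms_iff {n k : ℕ} (hm : 1 < k * n) {ω : Equiv.Perm ℤ} :
    ω ∈ stablePerms (k * n - 1) n ↔
      ω ∈ affinePerms n ∧ ∀ z, ω (z + 1) - ω z < (k : ℤ) * n := by
  refine and_congr_right fun hω => ?_
  have h1 := (mem_affinePerms_iff.mp hω).1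
  have key : ∀ z, ω (z + 1 + ((k * n - 1 : ℕ) : ℤ)) = ω z + k * n := fun z => by
    rw [← int_map_add_mul h1]
    congr 1
    rw [Nat.cast_sub hm.le]
    push_cast; ring
  constructor
  · intro h z
    have := h (z + 1)
    rw [key] at this
    linarith
  · intro h x
    have h1 := h (x - 1)
    have h2 := key (x - 1)
    rw [sub_add_cancel] at h1 h2
    rw [h2]; linarith

/-- If consecutive values of `ω` increase by less than `K`, then a function `g` that reverses the
order in which `ω` lists the pairs `a < b` with `b - a < K` does so for all pairs `a < b`. -/
theorem lt_of_step_lt {ω : Equiv.Perm ℤ} {K : ℤ} (hω : ∀ z, ω (z + 1) - ω z < K) {g : ℤ → ℝ}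
    (hg : ∀ a b, a < b → b - a < K → ω⁻¹ a < ω⁻¹ b → g b < g a) {a b : ℤ} (hab : a < b)
    (hu : ω⁻¹ a < ω⁻¹ b) : g b < g a := by
  induction hN : (ω⁻¹ b - ω⁻¹ a).toNat using Nat.strong_induction_on generalizing a b with
  | _ N ih =>
  rcases lt_or_ge (b - a) K with h | h
  · exact hg a b hab h hu
  -- Between the positions of `a` and `b`, the values of `ω` get from `a` to `b` with upward jumps
  -- less than `K ≤ b - a`, so they cannot skip the interval between them. An intermediate value
  -- splits the pair into two closer ones.
  obtain ⟨t, ht1, ht2, ht3, ht4⟩ : ∃ t, ω⁻¹ a < t ∧ t < ω⁻¹ b ∧ a < ω t ∧ ω t < b := by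
    by_contra! hno
    have hle : ∀ t, ω⁻¹ a ≤ t → t < ω⁻¹ b → ω t ≤ a := fun t ht => by
      induction t, ht using Int.leInduction with
      | base => intro _; simp
      | succ t ht ih =>
        intro hlt
        have h1 := ih (by omega)
        by_contra! h2
        have h3 := hno (t + 1) (by omega) hlt h2
        have h4 := hω t
        omega
    have h1 := hle (ω⁻¹ b - 1) (by omega) (by omega)
    have h2 := hω (ω⁻¹ b - 1)
    rw [sub_add_cancel] at h2
    simp only [Equiv.Perm.inv_def, Equiv.apply_symm_apply] at h1 h2
    omega
  have e : ω⁻¹ (ω t) = t := by simp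
  refine (ih _ ?_ ht4 ?_ rfl).trans (ih _ ?_ ht3 ?_ rfl) <;> rw [e] <;> omega

theorem exists_abs_map_sub_le {n : ℕ} [NeZero n] {w : ℤ → ℤ} (hw : ∀ x, w (x + n) = w x + n) :
    ∃ C, ∀ b, |w b - b| ≤ C := by
  refine ⟨∑ i : Fin n, |w ((i : ℤ) + 1) - ((i : ℤ) + 1)|, fun b => ?_⟩
  obtain ⟨i, q, rfl⟩ := exists_eq_fin_add_mul n b
  rw [int_map_add_mul hw, add_sub_add_right_eq_sub]
  exact Finset.single_le_sum (f := fun i : Fin n => |w ((i : ℤ) + 1) - ((i : ℤ) + 1)|)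
    (fun _ _ => abs_nonneg _) (Finset.mem_univ i)

/-! ### The Shi region of a stable permutation. -/

/-- The region of the `k`-Shi arrangement that contains `x`. -/
def shiRegion (k : ℕ) {n : ℕ} (x : Fin n → ℝ) : Set (Fin n → ℝ) :=
  connectedComponentIn (sumZero n \ ⋃₀ shiArrangement n k) x

theorem abs_neg_lt_of_abs_lt {K : ℤ} : ∀ d : ℤ, |d| < K → |-d| < K := fun d h => by rwa [abs_neg]

theorem mem_compl_shiArrangement {n : ℕ} [NeZero n] (k : ℕ) {ω : Equiv.Perm ℤ}
    (hω : ω ∈ affinePerms n) {x : Fin n → ℝ} (hx : x ∈ alcoveOf n ω) :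
    x ∈ sumZero n \ ⋃₀ shiArrangement n k := by
  rw [shiArrangement_eq]
  exact mem_compl_of_injective abs_neg_lt_of_abs_lt ((mem_alcoveOf_iff hω).mp hx).1
    (injective_extCoord_of_mem_alcoveOf hω hx)

theorem mem_shiRegion_iff {n k : ℕ} [NeZero n] {x : Fin n → ℝ}
    (hx : x ∈ sumZero n \ ⋃₀ shiArrangement n k) {y : Fin n → ℝ} : y ∈ shiRegion k x ↔
      y ∈ sumZero n ∧ ∀ a b : ℤ, |b - a| < (k : ℤ) * n → extCoord x a < extCoord x b →
        extCoord y a < extCoord y b := by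
  rw [shiArrangement_eq] at hx
  rw [shiRegion, shiArrangement_eq, connectedComponentIn_compl_eq_order abs_neg_lt_of_abs_lt hx]
  rfl

theorem shiRegion_eq_of_mem {n k : ℕ} {x y : Fin n → ℝ} (h : y ∈ shiRegion k x) :
    shiRegion k x = shiRegion k y := connectedComponentIn_eq h

theorem alcoveOf_subset_shiRegion {n : ℕ} [NeZero n] (k : ℕ) {ω : Equiv.Perm ℤ}
    (hω : ω ∈ affinePerms n) {x : Fin n → ℝ} (hx : x ∈ alcoveOf n ω) :
    alcoveOf n ω ⊆ shiRegion k x := fun y hy => by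
  rw [mem_shiRegion_iff (mem_compl_shiArrangement k hω hx)]
  refine ⟨((mem_alcoveOf_iff hω).mp hy).1, fun a b _ h => ?_⟩
  rw [lt_iff_of_mem_alcoveOf hω hx] at h
  rwa [lt_iff_of_mem_alcoveOf hω hy]

/-- The region fixes the order of indices at distance less than `k n`; stability propagates this to
every noninversion of `ω`. So no point of the region has an inversion that `ω` lacks. Maximality,
boundedness and injectivity of `balc` all rest on this. -/
theorem extCoord_lt_of_mem_shiRegion {n k : ℕ} [NeZero n] (hm : 1 < k * n) {ω : Equiv.Perm ℤ}
    (hω : ω ∈ stablePerms (k * n - 1) n) {x : Fin n → ℝ} (hx : x ∈ alcoveOf n ω) {y : Fin n → ℝ}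
    (hy : y ∈ shiRegion k x) {a b : ℤ} (hab : a < b) (h : extCoord x b < extCoord x a) :
    extCoord y b < extCoord y a := by
  rw [mem_stablePerms_iff hm] at hω
  rw [lt_iff_of_mem_alcoveOf hω.1 hx] at h
  refine lt_of_step_lt hω.2 (fun a b hab hlt hu => ?_) hab h
  rw [mem_shiRegion_iff (mem_compl_shiArrangement k hω.1 hx)] at hy
  refine hy.2 b a ?_ ((lt_iff_of_mem_alcoveOf hω.1 hx _ _).mpr hu)
  rw [abs_sub_comm, abs_of_pos (by omega)]
  exact hlt

theorem abs_le_of_forall_sub_le {n : ℕ} {y : Fin n → ℝ} (hy : y ∈ sumZero n) {L : ℝ}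
    (h : ∀ i j, y i - y j ≤ L) (i : Fin n) : |y i| ≤ L := by
  have hn : (0 : ℝ) < n := by exact_mod_cast i.pos
  have hs : ∑ j, y j = 0 := hy
  have h1 := Finset.sum_le_sum fun j (_ : j ∈ Finset.univ) => h i j
  have h2 := Finset.sum_le_sum fun j (_ : j ∈ Finset.univ) => h j i
  simp only [Finset.sum_sub_distrib, hs, Finset.sum_const, Finset.card_univ, Fintype.card_fin,
    nsmul_eq_mul, sub_zero, zero_sub] at h1 h2
  rw [abs_le]
  constructor
  · exact le_of_mul_le_mul_left (by linarith) hn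
  · exact le_of_mul_le_mul_left h1 hn

theorem isBounded_shiRegion {n k : ℕ} [NeZero n] (hm : 1 < k * n) {ω : Equiv.Perm ℤ}
    (hω : ω ∈ stablePerms (k * n - 1) n) {x : Fin n → ℝ} (hx : x ∈ alcoveOf n ω) :
    Bornology.IsBounded (shiRegion k x) := by
  obtain ⟨L, hL⟩ := exists_nat_gt (∑ p : Fin n × Fin n, |x p.1 - x p.2|)
  have hL' : ∀ i j, x i - x j < L := fun i j => (le_abs_self _).trans_lt
    ((Finset.single_le_sum (f := fun p : Fin n × Fin n => |x p.1 - x p.2|)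
      (fun _ _ => abs_nonneg _) (Finset.mem_univ (i, j))).trans_lt hL)
  have hL1 : (1 : ℤ) ≤ L := by
    have := hL' 0 0
    rw [sub_self] at this
    exact_mod_cast this
  rw [isBounded_iff_forall_norm_le]
  refine ⟨L, fun y hy => (pi_norm_le_iff_of_nonneg (by positivity)).mpr ?_⟩
  have hV := ((mem_shiRegion_iff (mem_compl_shiArrangement k hω.1 hx)).mp hy).1
  refine abs_le_of_forall_sub_le hV fun i j => ?_
  have hj := j.isLt
  -- As `L` exceeds all coordinate differences of `x`, this pair is not inverted at `x`. Hence it is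
  -- not inverted at `y`, which says `y i - y j < L`.
  have hlt := extCoord_lt_of_mem_shiRegion hm hω hx hy
    (a := (j : ℤ) + 1) (b := (i : ℤ) + 1 + (L : ℤ) * n) ?_ ?_
  · rw [extCoord_coe, extCoord_fin_add] at hlt
    push_cast at hlt
    linarith
  · have := mul_le_mul_of_nonneg_right hL1 (show (0 : ℤ) ≤ n by positivity)
    have hi : (0 : ℤ) ≤ i := by positivity
    have : (j : ℤ) < n := by exact_mod_cast hj
    linarith
  · rw [extCoord_coe, extCoord_fin_add]
    have := hL' i j
    push_cast
    linarith

theorem isMaximalAlcove_shiRegion {n k : ℕ} [NeZero n] (hm : 1 < k * n) {ω : Equiv.Perm ℤ}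
    (hω : ω ∈ stablePerms (k * n - 1) n) {x : Fin n → ℝ} (hx : x ∈ alcoveOf n ω) :
    IsMaximalAlcove (alcoveOf n ω) (shiRegion k x) := by
  refine ⟨alcoveOf_mem_alcoves hω.1, alcoveOf_subset_shiRegion k hω.1 hx, fun B hB hBR => ?_⟩
  obtain ⟨ω', hω', rfl⟩ := exists_eq_alcoveOf hB
  obtain ⟨y, hy⟩ := alcoveOf_nonempty n ω'
  rw [separationCount_alcoveOf hω.1 hx, separationCount_alcoveOf hω' hy]
  refine Set.ncard_le_ncard (separatingSet_subset ((mem_alcoveOf_iff hω.1).mp hx).1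
    fun a b hab h => ?_) (finite_separatingSet x)
  by_contra! hle
  rcases hle.eq_or_lt with he | hlt
  · exact hab.ne' (injective_extCoord_of_mem_alcoveOf hω.1 hx he)
  · exact h.asymm (extCoord_lt_of_mem_shiRegion hm hω hx (hBR hy) hab hlt)

theorem shiRegion_mem_boundedShiRegions {n k : ℕ} [NeZero n] (hm : 1 < k * n) {ω : Equiv.Perm ℤ}
    (hω : ω ∈ stablePerms (k * n - 1) n) {x : Fin n → ℝ} (hx : x ∈ alcoveOf n ω) :
    shiRegion k x ∈ boundedShiRegions n k :=
  ⟨⟨x, mem_compl_shiArrangement k hω.1 hx, rfl⟩, isBounded_shiRegion hm hω hx⟩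

theorem balc_eq_of_isMaximalAlcove {n k : ℕ} [NeZero n] {ω : Equiv.Perm ℤ}
    {R : Set (Fin n → ℝ)} (hR : R ∈ boundedShiRegions n k)
    (hmax : IsMaximalAlcove (alcoveOf n ω) R) : balc n k ω = R := by
  have : {R | R ∈ boundedShiRegions n k ∧ IsMaximalAlcove (alcoveOf n ω) R} = {R} := by
    refine Set.eq_singleton_iff_unique_mem.mpr ⟨⟨hR, hmax⟩, ?_⟩
    obtain ⟨⟨x, -, rfl⟩, -⟩ := hR
    rintro _ ⟨⟨⟨y, -, rfl⟩, -⟩, hmax'⟩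
    obtain ⟨z, hz⟩ := alcoveOf_nonempty n ω
    exact (connectedComponentIn_eq (hmax'.2.1 hz)).trans
      (connectedComponentIn_eq (hmax.2.1 hz)).symm
  rw [balc, this, Set.sUnion_singleton]

theorem balc_eq_shiRegion {n k : ℕ} [NeZero n] (hm : 1 < k * n) {ω : Equiv.Perm ℤ}
    (hω : ω ∈ stablePerms (k * n - 1) n) {x : Fin n → ℝ} (hx : x ∈ alcoveOf n ω) :
    balc n k ω = shiRegion k x :=
  balc_eq_of_isMaximalAlcove (shiRegion_mem_boundedShiRegions hm hω hx)
    (isMaximalAlcove_shiRegion hm hω hx)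

theorem injOn_balc {n k : ℕ} [NeZero n] (hm : 1 < k * n) :
    Set.InjOn (balc n k) (stablePerms (k * n - 1) n) := by
  intro ω hω ω' hω' h
  obtain ⟨x, hx⟩ := alcoveOf_nonempty n ω
  obtain ⟨y, hy⟩ := alcoveOf_nonempty n ω'
  have hR : shiRegion k x = shiRegion k y := by
    rw [← balc_eq_shiRegion hm hω hx, ← balc_eq_shiRegion hm hω' hy, h]
  have hyx : y ∈ shiRegion k x := hR ▸ alcoveOf_subset_shiRegion k hω'.1 hy hy
  have hxy : x ∈ shiRegion k y := hR ▸ alcoveOf_subset_shiRegion k hω.1 hx hx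
  refine affinePerms_eq_of_order hω.1 hω'.1 fun a b hab => ?_
  rw [← lt_iff_of_mem_alcoveOf hω.1 hx] at hab
  rw [← lt_iff_of_mem_alcoveOf hω'.1 hy]
  have hne : a ≠ b := by rintro rfl; exact lt_irrefl _ hab
  rcases hne.lt_or_gt with hlt | hlt
  · exact extCoord_lt_of_mem_shiRegion hm hω hx hyx hlt hab
  · by_contra! hle
    rcases hle.eq_or_lt with he | hl
    · exact hne (injective_extCoord_of_mem_alcoveOf hω'.1 hy he)
    · exact hab.asymm (extCoord_lt_of_mem_shiRegion hm hω' hy hxy hlt hl)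

/-! ### Pak–Stanley labels and `PS`. -/

/-- The intersections of `T` with its two translates are translates of each other. This trades a
bound on differences of values for a bound on differences of positions. -/
theorem ncard_diff_image_add_eq {T : Set ℤ} (hT : T.Finite) (d : ℤ) :
    (T \ (· + d) '' T).ncard = (T \ (· - d) '' T).ncard := by
  have h1 := Set.ncard_inter_add_ncard_sdiff_eq_ncard T ((· + d) '' T) hT
  have h2 := Set.ncard_inter_add_ncard_sdiff_eq_ncard T ((· - d) '' T) hT
  have h3 : T ∩ (· + d) '' T = (· + d) '' (T ∩ (· - d) '' T) := by
    ext b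
    simp only [Set.mem_inter_iff, Set.mem_image]
    constructor
    · rintro ⟨hb, a, ha, rfl⟩
      exact ⟨a, ⟨ha, a + d, hb, by ring⟩, rfl⟩
    · rintro ⟨a, ⟨ha, c, hc, rfl⟩, rfl⟩
      exact ⟨by simpa using hc, c - d, ha, rfl⟩
  rw [h3, Set.ncard_image_of_injective _ (add_left_injective d)] at h1
  omega

/-- The number of inversions of `a` with larger values less than `a + k n` is `PS_ω(a)`. -/
theorem ncard_inversions_eq_psMap {n k : ℕ} [NeZero n] (hm : 1 < k * n) {ω : Equiv.Perm ℤ}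
    (hω : ω ∈ stablePerms (k * n - 1) n) (a : Fin n) :
    {b : ℤ | (a : ℤ) + 1 < b ∧ b - ((a : ℤ) + 1) < k * n ∧ ω⁻¹ b < ω⁻¹ ((a : ℤ) + 1)}.ncard =
      psMap (k * n - 1) n ω a := by
  have hadd := int_map_add_mul (inv_map_add (mem_affinePerms_iff.mp hω.1).1)
  obtain ⟨C, hC⟩ := exists_abs_map_sub_le (inv_map_add (mem_affinePerms_iff.mp hω.1).1)
  set a' := (a : ℤ) + 1 with ha'
  have hT : {b : ℤ | a' < b ∧ ω⁻¹ b < ω⁻¹ a'}.Finite := by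
    refine (Set.finite_Icc a' (ω⁻¹ a' + C)).subset fun b hb => ⟨hb.1.le, ?_⟩
    have := (abs_le.mp (hC b)).1
    have := hb.2
    linarith
  have hkn : ((k * n - 1 : ℕ) : ℤ) = k * n - 1 := by
    rw [Nat.cast_sub hm.le]; push_cast; ring
  have hkn' : (1 : ℤ) < k * n := by exact_mod_cast hm
  have h := ncard_diff_image_add_eq hT (k * n)
  simp only [psMap, ← ha']
  convert h using 2
  · ext b
    simp only [Set.mem_sdiff, Set.mem_image, Set.mem_ofPred_eq, not_exists, not_and]
    constructor
    · rintro ⟨h1, h2, h3⟩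
      exact ⟨⟨h1, h3⟩, fun c hc e => by omega⟩
    · rintro ⟨⟨h1, h3⟩, h2⟩
      refine ⟨h1, ?_, h3⟩
      by_contra! hge
      have e := hadd (b - k * n) k
      rw [sub_add_cancel] at e
      rcases hge.eq_or_lt with he | hlt
      · rw [show b - k * n = a' by omega] at e
        omega
      · exact h2 (b - k * n) ⟨by omega, by omega⟩ (by ring)
  · ext b
    simp only [Set.mem_sdiff, Set.mem_image, Set.mem_ofPred_eq, not_exists, not_and, hkn]
    have e := hadd b k
    constructor
    · rintro ⟨h1, h2, h3⟩
      refine ⟨⟨h1, by omega⟩, fun c hc he => ?_⟩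
      rw [show b + k * n = c by omega] at e
      omega
    · rintro ⟨⟨h1, h2⟩, h3⟩
      have h4 : ¬ ω⁻¹ (b + k * n) < ω⁻¹ a' := fun h' =>
        h3 (b + k * n) ⟨by omega, h'⟩ (by ring)
      have h5 : ω⁻¹ b + k * n ≠ ω⁻¹ a' := fun h' => by
        rw [← e] at h'
        have := ω⁻¹.injective h'
        omega
      -- Stability excludes the position difference `k n - 1`, so the bound `k n` sharpens to the
      -- bound `m = k n - 1` of `PS`.
      have h6 : ω⁻¹ b + (k * n - 1) ≠ ω⁻¹ a' := fun h' => by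
        have := hω.2 (ω⁻¹ b)
        rw [hkn, h'] at this
        simp only [Equiv.Perm.inv_def, Equiv.apply_symm_apply] at this
        omega
      refine ⟨h1, by omega, ?_⟩
      omega

theorem pakStanley_shiRegion {n k : ℕ} [NeZero n] (hm : 1 < k * n) {ω : Equiv.Perm ℤ}
    (hω : ω ∈ stablePerms (k * n - 1) n) {x : Fin n → ℝ} (hx : x ∈ alcoveOf n ω) :
    pakStanley n k (shiRegion k x) = psMap (k * n - 1) n ω := by
  ext a
  rw [← ncard_inversions_eq_psMap hm hω a]
  set T := {b : ℤ | (a : ℤ) + 1 < b ∧ b - ((a : ℤ) + 1) < k * n ∧ ω⁻¹ b < ω⁻¹ ((a : ℤ) + 1)}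
  have hn : (n : ℤ) ≠ 0 := by exact_mod_cast NeZero.ne n
  have hTfin : T.Finite := (Set.finite_Icc ((a : ℤ) + 1) ((a : ℤ) + 1 + k * n)).subset
    fun b hb => ⟨hb.1.le, by have := hb.2.1; linarith⟩
  have hxc := mem_compl_shiArrangement k hω.1 hx
  have hV := ((mem_alcoveOf_iff hω.1).mp hx).1
  have hord := lt_iff_of_mem_alcoveOf hω.1 hx
  have hsub : ∀ (i j : Fin n) (l : ℤ), i < j → -(k : ℤ) < l → l ≤ k →
      (shiRegion k x ⊆ farSide i j l ↔ x ∈ farSide i j l) := fun i j l hij h1 h2 => by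
    rw [shiRegion, shiArrangement_eq]
    rw [shiArrangement_eq] at hxc
    exact connectedComponentIn_subset_farSide_iff abs_neg_lt_of_abs_lt hxc hij
      ((abs_sub_mul_lt_iff hij l).mpr ⟨h1, h2⟩)
  set S₁ := {p : Fin n × ℤ | a < p.1 ∧ -(k : ℤ) < p.2 ∧ p.2 ≤ 0 ∧
    shiRegion k x ⊆ farSide a p.1 p.2}
  set S₂ := {p : Fin n × ℤ | p.1 < a ∧ 0 < p.2 ∧ p.2 ≤ k ∧ shiRegion k x ⊆ farSide p.1 a p.2}
  set φ : Fin n × ℤ → ℤ := fun p => (p.1 : ℤ) + 1 + p.2 * n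
  have hφ : Function.Injective φ := by
    rintro ⟨i, q⟩ ⟨j, r⟩ h
    simp only [φ] at h
    obtain rfl := fin_eq_of_dvd_sub (i := i) (j := j) ⟨r - q, by linarith⟩
    have : (q : ℤ) * n = r * n := by linarith
    rw [mul_right_cancel₀ hn this]
  have hψ : Function.Injective fun p : Fin n × ℤ => φ (p.1, -p.2) := by
    rintro ⟨i, q⟩ ⟨j, r⟩ h
    have := hφ h
    simpa using this
  have h₁ : ∀ j l, (j, l) ∈ S₁ ↔ a < j ∧ φ (j, -l) ∈ T := fun j l => by
    refine and_congr_right fun hij => ?_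
    obtain ⟨e1, -⟩ := fin_pair_lt_iff hij l
    have e3 := abs_sub_mul_lt_iff (k := k) hij l
    have e4 : φ (j, -l) - ((a : ℤ) + 1) = (j : ℤ) - a - l * n := by simp only [φ]; ring
    change _ ↔ (a : ℤ) + 1 < φ (j, -l) ∧ φ (j, -l) - ((a : ℤ) + 1) < k * n ∧ _
    constructor
    · rintro ⟨h1, h2, h3⟩
      rw [hsub a j l hij h1 (by omega), mem_farSide_iff_extCoord hij l rfl rfl] at h3
      have h5 := e1.mpr h2
      refine ⟨h5, ?_, ?_⟩
      · rw [e4]; exact (le_abs_self _).trans_lt (e3.mpr ⟨h1, by omega⟩)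
      · rw [← hord]
        rcases h3.2 with h | h
        · exact h.2
        · exact absurd h.1 h5.asymm
    · rintro ⟨h1, h2, h3⟩
      have h5 := e1.mp h1
      rw [e4] at h2
      have h6 := e3.mp (by rw [abs_of_pos (by linarith)]; exact h2)
      refine ⟨h6.1, h5, ?_⟩
      rw [hsub a j l hij h6.1 h6.2, mem_farSide_iff_extCoord hij l rfl rfl]
      exact ⟨hV, .inl ⟨h1, (hord _ _).mpr h3⟩⟩
  have h₂ : ∀ i l, (i, l) ∈ S₂ ↔ i < a ∧ φ (i, l) ∈ T := fun i l => by
    refine and_congr_right fun hij => ?_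
    obtain ⟨-, e2⟩ := fin_pair_lt_iff hij l
    have e3 := abs_sub_mul_lt_iff (k := k) hij l
    have e4 : φ (i, l) - ((a : ℤ) + 1) = -((a : ℤ) - i - l * n) := by simp only [φ]; ring
    have e5 : (a : ℤ) + 1 < φ (i, l) ↔ 0 < l := by
      rw [← e2]; simp only [φ]; constructor <;> intro h <;> linarith
    have e6 : (extCoord x ((a : ℤ) + 1 + (-l) * n) < extCoord x ((i : ℤ) + 1)) ↔
        ω⁻¹ (φ (i, l)) < ω⁻¹ ((a : ℤ) + 1) := by
      rw [← hord, extCoord_fin_add, extCoord_fin_add, extCoord_coe, extCoord_coe]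
      push_cast
      constructor <;> intro h <;> linarith
    change _ ↔ (a : ℤ) + 1 < φ (i, l) ∧ φ (i, l) - ((a : ℤ) + 1) < k * n ∧ _
    constructor
    · rintro ⟨h1, h2, h3⟩
      rw [hsub i a l hij (by omega) h2, mem_farSide_iff_extCoord hij l rfl rfl] at h3
      refine ⟨e5.mpr h1, ?_, ?_⟩
      · rw [e4]; exact (neg_le_abs _).trans_lt (e3.mpr ⟨by omega, h2⟩)
      · rcases h3.2 with h | h
        · exact absurd h.1 (e2.mpr h1).asymm
        · exact e6.mp h.2
    · rintro ⟨h1, h2, h3⟩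
      have h5 := e5.mp h1
      rw [e4] at h2
      have h6 := e3.mp (by rw [abs_of_neg (by linarith)]; exact h2)
      refine ⟨h5, h6.2, ?_⟩
      rw [hsub i a l hij h6.1 h6.2, mem_farSide_iff_extCoord hij l rfl rfl]
      exact ⟨hV, .inr ⟨e2.mpr h5, e6.mpr h3⟩⟩
  -- An inversion `b` of `a + 1` is classified by its residue: a residue above `a` gives the first
  -- kind of hyperplane in the label, one below `a` the second. The residue of `a` itself gives no
  -- inversion, by periodicity.
  have hT : T = (fun p : Fin n × ℤ => φ (p.1, -p.2)) '' S₁ ∪ φ '' S₂ := by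
    ext b
    constructor
    · intro hb
      obtain ⟨j, q, rfl⟩ := exists_eq_fin_add_mul n b
      rcases lt_trichotomy a j with h | rfl | h
      · exact .inl ⟨(j, -q), (h₁ _ _).mpr ⟨h, by simpa [φ] using hb⟩, by simp [φ]⟩
      · have h1 := hb.1
        have h2 := hb.2.2
        rw [int_map_add_mul (inv_map_add (mem_affinePerms_iff.mp hω.1).1)] at h2
        omega
      · exact .inr ⟨(j, q), (h₂ _ _).mpr ⟨h, hb⟩, rfl⟩
    · rintro (⟨⟨j, l⟩, h, rfl⟩ | ⟨⟨j, l⟩, h, rfl⟩)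
      · exact ((h₁ _ _).mp h).2
      · exact ((h₂ _ _).mp h).2
  have hdisj : Disjoint ((fun p : Fin n × ℤ => φ (p.1, -p.2)) '' S₁) (φ '' S₂) := by
    rw [Set.disjoint_left]
    rintro _ ⟨⟨j, l⟩, h, rfl⟩ ⟨⟨i, r⟩, h', he⟩
    have := congrArg Prod.fst (hφ he)
    simp only at this
    subst this
    exact h.1.asymm h'.1
  rw [hT, Set.ncard_union_eq hdisj (hTfin.subset (by rw [hT]; exact Set.subset_union_left))
    (hTfin.subset (by rw [hT]; exact Set.subset_union_right)),
    Set.ncard_image_of_injective _ hψ, Set.ncard_image_of_injective _ hφ]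
  rfl

/-! ### Wall crossing and surjectivity of `balc`. -/

/-- The simple transposition exchanging `w` and `w + 1` for all `w` congruent to `z`
modulo `n`. -/
def adjSwapFun (n : ℕ) (z w : ℤ) : ℤ :=
  if (n : ℤ) ∣ w - z then w + 1 else if (n : ℤ) ∣ w - 1 - z then w - 1 else w

theorem not_dvd_one_of_two_le {n : ℕ} (hn : 2 ≤ n) : ¬ (n : ℤ) ∣ 1 := fun h => by
  have := Int.le_of_dvd one_pos h
  omega

theorem adjSwapFun_involutive {n : ℕ} (hn : 2 ≤ n) (z : ℤ) :
    Function.Involutive (adjSwapFun n z) := by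
  have h1 := not_dvd_one_of_two_le hn
  intro w
  unfold adjSwapFun
  by_cases ha : (n : ℤ) ∣ w - z
  · have hb : ¬ (n : ℤ) ∣ w + 1 - z := fun h => h1 (by simpa using dvd_sub h ha)
    have hc : (n : ℤ) ∣ w + 1 - 1 - z := by simpa using ha
    simp only [ha, hb, hc, if_true, if_false]; ring
  · by_cases hb : (n : ℤ) ∣ w - 1 - z
    · simp only [ha, hb, if_true, if_false]; ring
    · simp only [ha, hb, if_false]

theorem adjSwapFun_add (n : ℕ) (z w : ℤ) : adjSwapFun n z (w + n) = adjSwapFun n z w + n := by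
  have h1 : (n : ℤ) ∣ w + n - z ↔ (n : ℤ) ∣ w - z := by
    rw [show w + n - z = w - z + n by ring]; exact dvd_add_self_right
  have h2 : (n : ℤ) ∣ w + n - 1 - z ↔ (n : ℤ) ∣ w - 1 - z := by
    rw [show w + n - 1 - z = w - 1 - z + n by ring]; exact dvd_add_self_right
  simp only [adjSwapFun, h1, h2]
  split_ifs <;> ring

/-- For `n = 1` the classes of `z` and `z + 1` coincide and `adjSwapFun` is a translation, not an
involution. -/
def adjSwap {n : ℕ} (hn : 2 ≤ n) (z : ℤ) : Equiv.Perm ℤ := (adjSwapFun_involutive hn z).toPerm _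

theorem adjSwap_mem_affinePerms {n : ℕ} [NeZero n] (hn : 2 ≤ n) (z : ℤ) :
    adjSwap hn z ∈ affinePerms n := by
  rw [mem_affinePerms_iff]
  refine ⟨adjSwapFun_add n z, ?_⟩
  have h1 := not_dvd_one_of_two_le hn
  have hδ : ∀ w, adjSwap hn z w = w + (if (n : ℤ) ∣ w - z then 1 else 0) -
      (if (n : ℤ) ∣ w - 1 - z then 1 else 0) := fun w => by
    change adjSwapFun n z w = _
    unfold adjSwapFun
    by_cases ha : (n : ℤ) ∣ w - z
    · have hc : ¬ (n : ℤ) ∣ w - 1 - z := fun h => h1 (by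
        have := dvd_sub ha h
        rwa [show w - z - (w - 1 - z) = 1 by ring] at this)
      simp [ha, hc]
    · by_cases hb : (n : ℤ) ∣ w - 1 - z <;> simp [ha, hb]
  -- The displacement of the swap is an indicator minus its translate, so it sums to zero over a
  -- period.
  have hs := sum_comp_of_periodic (n := n) (w := fun w => w - 1)
    (h := fun w => if (n : ℤ) ∣ w - z then (1 : ℤ) else 0) (fun w => by ring)
    (sub_left_injective) (fun w => by
      simp only [show w + n - z = w - z + n by ring, dvd_add_self_right])
  simp only [hδ, Finset.sum_sub_distrib, Finset.sum_add_distrib] at hs ⊢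
  rw [hs]; ring

theorem adjSwap_lt {n : ℕ} (hn : 2 ≤ n) {z p q : ℤ} (hpq : p < q)
    (h : ¬ (q = p + 1 ∧ (n : ℤ) ∣ p - z)) : adjSwap hn z p < adjSwap hn z q := by
  have h1 := not_dvd_one_of_two_le hn
  change adjSwapFun n z p < adjSwapFun n z q
  have hq : q - 1 ≤ adjSwapFun n z q := by unfold adjSwapFun; split_ifs <;> omega
  by_cases ha : (n : ℤ) ∣ p - z
  · have hp : adjSwapFun n z p = p + 1 := if_pos ha
    rw [hp]
    have hq1 : q ≠ p + 1 := fun e => h ⟨e, ha⟩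
    by_cases hq2 : q = p + 2
    · subst hq2
      have hc : ¬ (n : ℤ) ∣ p + 2 - 1 - z := fun h' => h1 (by
        have := dvd_sub h' ha
        rwa [show p + 2 - 1 - z - (p - z) = 1 by ring] at this)
      unfold adjSwapFun
      split_ifs <;> omega
    · omega
  · have hp : adjSwapFun n z p ≤ p := by
      unfold adjSwapFun; rw [if_neg ha]; split_ifs <;> omega
    by_cases hq1 : q = p + 1
    · subst hq1
      have hc : ¬ (n : ℤ) ∣ p + 1 - 1 - z := by simpa using ha
      have : p + 1 ≤ adjSwapFun n z (p + 1) := by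
        unfold adjSwapFun; rw [if_neg hc]; split_ifs <;> omega
      omega
    · omega

theorem adjSwap_self {n : ℕ} (hn : 2 ≤ n) (z : ℤ) : adjSwap hn z z = z + 1 := by
  change adjSwapFun n z z = _
  simp [adjSwapFun]

theorem adjSwap_succ {n : ℕ} (hn : 2 ≤ n) (z : ℤ) : adjSwap hn z (z + 1) = z := by
  rw [← adjSwap_self hn z]
  exact adjSwapFun_involutive hn z z

theorem adjSwap_inv {n : ℕ} (hn : 2 ≤ n) (z : ℤ) : (adjSwap hn z)⁻¹ = adjSwap hn z := by
  ext w
  rw [Equiv.Perm.inv_eq_iff_eq]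
  exact (adjSwapFun_involutive hn z w).symm

theorem mul_mem_affinePerms {n : ℕ} [NeZero n] {ω σ : Equiv.Perm ℤ} (hω : ω ∈ affinePerms n)
    (hσ : σ ∈ affinePerms n) : ω * σ ∈ affinePerms n := by
  have h1 := (mem_affinePerms_iff.mp hω)
  have h2 := (mem_affinePerms_iff.mp hσ)
  rw [mem_affinePerms_iff]
  refine ⟨fun x => by simp [h1.1, h2.1], ?_⟩
  rw [← h1.2]
  have := sum_comp_of_mem_affinePerms hσ (g := fun x => ((ω x : ℤ) : ℝ)) (c := n)
    (fun x => by rw [h1.1]; push_cast; ring)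
  exact_mod_cast this

/-- Crossing a wall of an alcove that is not in the `k`-Shi arrangement stays in the region. -/
theorem exists_separationCount_lt {n k : ℕ} [NeZero n] (hm : 1 < k * n) {ω : Equiv.Perm ℤ}
    (hω : ω ∈ affinePerms n) {x : Fin n → ℝ} (hx : x ∈ alcoveOf n ω) {z : ℤ}
    (hz : (k : ℤ) * n ≤ ω (z + 1) - ω z) :
    ∃ ω' ∈ affinePerms n, alcoveOf n ω' ⊆ shiRegion k x ∧
      separationCount (alcoveOf n ω) < separationCount (alcoveOf n ω') := by
  have hkn : (1 : ℤ) < k * n := by exact_mod_cast hm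
  have hper := (mem_affinePerms_iff.mp hω).1
  -- A difference divisible by `n` would, by periodicity, equal `(z + 1) - z = 1`, which is less
  -- than `k n`.
  have hdvd : ¬ (n : ℤ) ∣ ω (z + 1) - ω z := by
    rintro ⟨q, hq⟩
    have h1 := int_map_add_mul hper z q
    have h2 : z + q * n = z + 1 := ω.injective (by rw [h1]; linarith)
    rw [mul_comm] at hq
    omega
  have hn : 2 ≤ n := by
    by_contra! h
    have : n = 1 := by have := NeZero.pos n; omega
    subst this
    simp at hdvd
  have hω' : ω * adjSwap hn z ∈ affinePerms n :=
    mul_mem_affinePerms hω (adjSwap_mem_affinePerms hn z)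
  have hinv : ∀ a, (ω * adjSwap hn z)⁻¹ a = adjSwap hn z (ω⁻¹ a) := fun a => by
    rw [mul_inv_rev, adjSwap_inv]; rfl
  -- The only pairs whose order changes are the translates of `ω z` and `ω (z + 1)`, which are at
  -- least `k n` apart and thus not compared by the Shi arrangement.
  have key : ∀ a b, ω⁻¹ a < ω⁻¹ b → b - a < k * n →
      (ω * adjSwap hn z)⁻¹ a < (ω * adjSwap hn z)⁻¹ b := fun a b hab hlt => by
    rw [hinv, hinv]
    refine adjSwap_lt hn hab ?_
    rintro ⟨h1, q, h2⟩
    have ha : a = ω (z + q * n) := by rw [← Equiv.Perm.inv_eq_iff_eq]; linarith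
    have hb : b = ω (z + 1 + q * n) := by rw [← Equiv.Perm.inv_eq_iff_eq]; linarith
    rw [int_map_add_mul hper] at ha hb
    linarith
  refine ⟨_, hω', fun y hy => ?_, ?_⟩
  · rw [mem_shiRegion_iff (mem_compl_shiArrangement k hω hx)]
    refine ⟨((mem_alcoveOf_iff hω').mp hy).1, fun a b hd h => ?_⟩
    rw [lt_iff_of_mem_alcoveOf hω hx] at h
    rw [lt_iff_of_mem_alcoveOf hω' hy]
    exact key b a h (by have := (abs_lt.mp hd).1; linarith)
  · obtain ⟨y, hy⟩ := alcoveOf_nonempty n (ω * adjSwap hn z)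
    rw [separationCount_alcoveOf hω hx, separationCount_alcoveOf hω' hy]
    refine Set.ncard_lt_ncard ?_ (finite_separatingSet y)
    have hVy := ((mem_alcoveOf_iff hω').mp hy).1
    refine (Set.ssubset_iff_exists).mpr ⟨separatingSet_subset hVy fun a b hab h => ?_, ?_⟩
    · rw [lt_iff_of_mem_alcoveOf hω hx] at h
      rw [lt_iff_of_mem_alcoveOf hω' hy]
      exact key b a h (by omega)
    · have e1 : ω⁻¹ (ω z) = z := by simp
      have e2 : ω⁻¹ (ω (z + 1)) = z + 1 := by simp
      have hnx : extCoord x (ω (z + 1)) < extCoord x (ω z) := by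
        rw [lt_iff_of_mem_alcoveOf hω hx, e1, e2]; omega
      have hny : extCoord y (ω z) < extCoord y (ω (z + 1)) := by
        rw [lt_iff_of_mem_alcoveOf hω' hy, hinv, hinv, e1, e2, adjSwap_self, adjSwap_succ]; omega
      have hlt : ω z < ω (z + 1) := by omega
      obtain ⟨i, j, l, t, hij, ⟨h1, h2⟩ | ⟨h1, h2⟩⟩ := exists_pair_eq n hdvd
      all_goals
        refine ⟨(i, j, l), ⟨hij, ?_⟩, fun hmem => ?_⟩
        · rw [mem_farSide_iff_extCoord hij l rfl rfl]
          refine ⟨hVy, ?_⟩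
          rw [h1, h2] at hlt hny
          simp only [extCoord_add_mul _ _ t] at hny
          first
            | exact .inl ⟨by linarith, by linarith⟩
            | exact .inr ⟨by linarith, by linarith⟩
        · have := hmem.2
          rw [mem_farSide_iff_extCoord hij l rfl rfl] at this
          rw [h1, h2] at hlt hnx
          simp only [extCoord_add_mul _ _ t] at hnx
          rcases this.2 with h | h <;> linarith [h.1, h.2]

/-- Every `k`-Shi region contains an alcove. -/
theorem exists_alcoveOf_subset {n k : ℕ} [NeZero n] {x : Fin n → ℝ}
    (hx : x ∈ sumZero n \ ⋃₀ shiArrangement n k) :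
    ∃ ω ∈ affinePerms n, alcoveOf n ω ⊆ shiRegion k x := by
  obtain ⟨v, hv⟩ := fundamentalAlcove_nonempty n
  have hvne : ∀ i j : Fin n, i < j → v i - v j ≠ 0 := fun i j hij =>
    (sub_pos.mpr (hv.2.1 hij)).ne'
  -- Perturb `x` in the direction of a point `v` of `A₀`, whose coordinates are distinct. Then only
  -- countably many `ε` put `x + ε v` on the affine braid arrangement.
  set C : Set ℝ := Set.range fun p : Fin n × Fin n × ℤ =>
    (p.2.2 - (x p.1 - x p.2.1)) / (v p.1 - v p.2.1)
  have hC : Dense Cᶜ := (Set.countable_range _).dense_compl ℝ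
  have hev : ∀ᶠ ε : ℝ in nhds 0, ∀ i j : Fin n, ∀ l : ℤ, i < j → -(k : ℤ) < l → l ≤ k →
      0 < (x i - x j - l) * ((x + ε • v) i - (x + ε • v) j - l) := by
    have : ∀ i j : Fin n, ∀ᶠ ε : ℝ in nhds 0, ∀ l ∈ Finset.Icc (-(k : ℤ)) k, i < j → -(k : ℤ) < l →
        l ≤ k → 0 < (x i - x j - l) * ((x + ε • v) i - (x + ε • v) j - l) := fun i j => by
      rw [Filter.eventually_all_finset]
      intro l _
      by_cases h : i < j ∧ -(k : ℤ) < l ∧ l ≤ k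
      · have hne : x i - x j - l ≠ 0 := fun h0 =>
          hx.2 ⟨_, ⟨i, j, l, h.1, h.2.1, h.2.2, rfl⟩, hx.1, by linarith⟩
        have hcont : Continuous fun ε : ℝ =>
            (x i - x j - l) * ((x + ε • v) i - (x + ε • v) j - l) := by
          simp only [Pi.add_apply, Pi.smul_apply, smul_eq_mul]
          fun_prop
        refine (hcont.tendsto 0).eventually (lt_mem_nhds ?_) |>.mono fun ε h' _ _ _ => h'
        simpa using mul_self_pos.mpr hne
      · exact .of_forall fun ε h1 h2 h3 => absurd ⟨h1, h2, h3⟩ h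
    filter_upwards [Filter.eventually_all.mpr fun i => Filter.eventually_all.mpr (this i)]
      with ε h i j l hij h1 h2
    exact h i j l (Finset.mem_Icc.mpr ⟨h1.le, h2⟩) hij h1 h2
  obtain ⟨ε, h1, h2⟩ := hC.inter_nhds_nonempty hev
  have hV : x + ε • v ∈ sumZero n := by
    have e1 : ∑ i, x i = 0 := hx.1
    have e2 : ∑ i, v i = 0 := hv.1
    simp [sumZero, Finset.sum_add_distrib, ← Finset.mul_sum, e1, e2]
  have hgen : x + ε • v ∈ sumZero n \ ⋃₀ affineBraid n := by
    refine ⟨hV, ?_⟩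
    rintro ⟨_, ⟨i, j, l, hij, rfl⟩, -, he⟩
    refine h1 ⟨(i, j, l), ?_⟩
    simp only [Pi.add_apply, Pi.smul_apply, smul_eq_mul] at he
    rw [div_eq_iff (hvne i j hij)]
    linarith
  have hreg : x + ε • v ∈ shiRegion k x := by
    rw [shiArrangement_eq] at hx
    rw [shiRegion, shiArrangement_eq, connectedComponentIn_compl_eq hx]
    refine ⟨hV, fun i j l hij hq => ?_⟩
    rw [abs_sub_mul_lt_iff hij] at hq
    exact h2 i j l hij hq.1 hq.2
  rw [affineBraid_eq, mem_compl_differenceArrangement fun _ h => h] at hgen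
  obtain ⟨ω, hω, h⟩ := exists_mem_alcoveOf hV fun a b hab => by
    by_contra hne
    exact hgen.2 a b hne trivial hab
  exact ⟨ω, hω, shiRegion_eq_of_mem hreg ▸ alcoveOf_subset_shiRegion k hω h⟩

theorem surjOn_balc {n k : ℕ} [NeZero n] (hm : 1 < k * n) :
    Set.SurjOn (balc n k) (stablePerms (k * n - 1) n) (boundedShiRegions n k) := by
  rintro R ⟨⟨x, hx, rfl⟩, hb⟩
  change Bornology.IsBounded (shiRegion k x) at hb
  change shiRegion k x ∈ _
  obtain ⟨B, hB⟩ := isBounded_iff_forall_norm_le.mp hb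
  obtain ⟨L, hL⟩ := exists_nat_ge (2 * B)
  -- Boundedness of the region bounds the levels of separating hyperplanes, so a largest separation
  -- count exists; an alcove attaining it must be stable.
  set S : Set ℕ := {N | ∃ ω ∈ affinePerms n, alcoveOf n ω ⊆ shiRegion k x ∧
    separationCount (alcoveOf n ω) = N}
  have hne : S.Nonempty := by
    obtain ⟨ω, hω, h⟩ := exists_alcoveOf_subset hx
    exact ⟨_, ω, hω, h, rfl⟩
  have hbdd : BddAbove S := by
    refine ⟨((Set.univ : Set (Fin n)) ×ˢ (Set.univ : Set (Fin n)) ×ˢ Set.Icc (-(L : ℤ)) L).ncard, ?_⟩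
    rintro _ ⟨ω, hω, h, rfl⟩
    obtain ⟨y, hy⟩ := alcoveOf_nonempty n ω
    rw [separationCount_alcoveOf hω hy]
    refine Set.ncard_le_ncard (separatingSet_subset_box (L := L) fun i j => ?_) (finite_box n L)
    have h1 := abs_le.mp ((norm_le_pi_norm y i).trans (hB y (h hy)))
    have h2 := abs_le.mp ((norm_le_pi_norm y j).trans (hB y (h hy)))
    push_cast
    linarith [h1.2, h2.1]
  obtain ⟨ω, hω, hsub, hcount⟩ := Nat.sSup_mem hne hbdd
  obtain ⟨y, hy⟩ := alcoveOf_nonempty n ω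
  have hreg := shiRegion_eq_of_mem (hsub hy)
  have hst : ω ∈ stablePerms (k * n - 1) n := by
    rw [mem_stablePerms_iff hm]
    refine ⟨hω, fun z => ?_⟩
    by_contra! hz
    obtain ⟨ω', hω', h1, h2⟩ := exists_separationCount_lt hm hω hy hz
    have := le_csSup hbdd ⟨ω', hω', hreg ▸ h1, rfl⟩
    omega
  exact ⟨ω, hst, by rw [balc_eq_shiRegion hm hst hy, hreg]⟩

theorem bijOn_balc {n k : ℕ} [NeZero n] (hm : 1 < k * n) :
    Set.BijOn (balc n k) (stablePerms (k * n - 1) n) (boundedShiRegions n k) := by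
  refine ⟨fun ω hω => ?_, injOn_balc hm, surjOn_balc hm⟩
  obtain ⟨x, hx⟩ := alcoveOf_nonempty n ω
  rw [balc_eq_shiRegion hm hω hx]
  exact shiRegion_mem_boundedShiRegions hm hω hx

theorem isMaximalAlcove_balc {n k : ℕ} [NeZero n] (hm : 1 < k * n) {ω : Equiv.Perm ℤ}
    (hω : ω ∈ stablePerms (k * n - 1) n) : IsMaximalAlcove (alcoveOf n ω) (balc n k ω) := by
  obtain ⟨x, hx⟩ := alcoveOf_nonempty n ω
  rw [balc_eq_shiRegion hm hω hx]
  exact isMaximalAlcove_shiRegion hm hω hx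

theorem pakStanley_balc {n k : ℕ} [NeZero n] (hm : 1 < k * n) {ω : Equiv.Perm ℤ}
    (hω : ω ∈ stablePerms (k * n - 1) n) :
    pakStanley n k (balc n k ω) = psMap (k * n - 1) n ω := by
  obtain ⟨x, hx⟩ := alcoveOf_nonempty n ω
  rw [balc_eq_shiRegion hm hω hx, pakStanley_shiRegion hm hω hx]

/-! ### The parking condition in counting form. -/

theorem lt_of_forall_mul_le_card {m n : ℕ} (hm : 0 < m) {f : Fin n → ℕ}
    (h : ∀ j ≤ m, n * j ≤ m * (Finset.univ.filter fun a => f a < j).card) (a : Fin n) :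
    f a < m := by
  have h1 := h m le_rfl
  rw [mul_comm] at h1
  have h2 := Nat.le_of_mul_le_mul_left h1 hm
  have h3 : (Finset.univ.filter fun a => f a < m) = Finset.univ := by
    rw [← Finset.card_eq_iff_eq_univ]
    exact le_antisymm (Finset.card_le_univ _) (by simpa using h2)
  have := Finset.mem_univ a
  rw [← h3] at this
  exact (Finset.mem_filter.mp this).2

/-- In decreasing order only rows above a given one can be strictly shorter. So the diagonal bound
at a row of length `j` corresponds to a lower bound for the number of rows shorter than `j`. -/
theorem mem_parkingFunctions_iff {m n : ℕ} (hm : 0 < m) {f : Fin n → ℕ} :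
    f ∈ parkingFunctions m n ↔
      ∀ j ≤ m, n * j ≤ m * (Finset.univ.filter fun a => f a < j).card := by
  constructor
  · rintro ⟨σ, hσ, h⟩ j hj
    have hcard : (Finset.univ.filter fun a => f a < j).card =
        (Finset.univ.filter fun i => f (σ i) < j).card := by
      symm
      rw [← Finset.card_map σ.toEmbedding]
      congr 1
      ext a
      simp only [Finset.mem_filter, Finset.mem_univ, true_and, Finset.mem_map_equiv,
        Equiv.apply_symm_apply]
    rw [hcard]
    set N := (Finset.univ.filter fun i => f (σ i) < j).card
    have hN : N ≤ n := (Finset.card_le_univ _).trans (by simp)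
    rcases hN.eq_or_lt with he | hlt
    · rw [he, mul_comm]; exact Nat.mul_le_mul_right n hj
    · set i₀ : Fin n := ⟨n - N - 1, by omega⟩
      have hj₀ : j ≤ f (σ i₀) := by
        by_contra! hlt'
        have hsub : Finset.Ici i₀ ⊆ Finset.univ.filter fun i => f (σ i) < j := fun i hi => by
          simp only [Finset.mem_filter, Finset.mem_univ, true_and]
          exact (hσ (Finset.mem_Ici.mp hi)).trans_lt hlt'
        have := Finset.card_le_card hsub
        rw [Fin.card_Ici] at this
        change n - (n - N - 1) ≤ N at this
        omega
      have h1 := h i₀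
      have h2 : ((i₀ : ℕ) + 1) + N = n := by
        change n - N - 1 + 1 + N = n
        omega
      have h3 : m * ((i₀ : ℕ) + 1) + m * N = m * n := by rw [← mul_add, h2]
      have h4 := Nat.mul_le_mul_left n hj₀
      omega
  · intro h
    have hlt := lt_of_forall_mul_le_card hm h
    refine ⟨Fin.revPerm.trans (Tuple.sort f), fun i j hij =>
      Tuple.monotone_sort f (Fin.rev_le_rev.mpr hij), fun i => ?_⟩
    set σ : Equiv.Perm (Fin n) := Fin.revPerm.trans (Tuple.sort f)
    have hσ : Antitone (f ∘ σ) := fun i j hij => Tuple.monotone_sort f (Fin.rev_le_rev.mpr hij)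
    have h1 := h (f (σ i)) (hlt _).le
    have h2 : (Finset.univ.filter fun a => f a < f (σ i)).card ≤ n - 1 - i := by
      rw [← Fin.card_Ioi, ← Finset.card_map σ.toEmbedding (s := Finset.Ioi i)]
      refine Finset.card_le_card fun a ha => ?_
      simp only [Finset.mem_filter, Finset.mem_univ, true_and] at ha
      rw [Finset.mem_map_equiv, Finset.mem_Ioi]
      by_contra! hle
      have : f (σ i) ≤ f (σ (σ.symm a)) := hσ hle
      rw [Equiv.apply_symm_apply] at this
      omega
    have h3 := Nat.mul_le_mul_left m h2
    have h4 : m * (n - 1 - i) + m * ((i : ℕ) + 1) = m * n := by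
      rw [← mul_add]; congr 1; omega
    omega

/-! ### Track systems of stable permutations. -/

/-- `s α` lists in increasing order representatives of the residues modulo `m`, and `s (α + 1)`
arises from `s α` by adding `m` to the entry with index `f α` and sorting. -/
structure IsTrackSystem (m n : ℕ) (s : ℤ → Fin m → ℤ) (f : ℤ → Fin m) : Prop where
  strictMono : ∀ α, StrictMono (s α)
  residues : ∀ α i j, (m : ℤ) ∣ s α i - s α j → i = j
  step : ∀ α, ∃ π : Equiv.Perm (Fin m), ∀ i, s (α + 1) (π i) = s α i + if i = f α then (m : ℤ) else 0
  period : ∀ α i, s (α + n) i = s α i + n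

theorem exists_perm_of_range_eq {ι X : Type*} {v w : ι → X} (hv : Function.Injective v)
    (hw : Function.Injective w) (h : Set.range v = Set.range w) :
    ∃ π : Equiv.Perm ι, ∀ i, w (π i) = v i :=
  ⟨(Equiv.ofInjective v hv).trans ((Equiv.setCongr h).trans (Equiv.ofInjective w hw).symm),
    fun i => by simp [Equiv.apply_ofInjective_symm]⟩

/-- The integers that are congruent modulo `m` to an entry of `s` and not smaller than it. -/
def aboveSet {m : ℕ} (s : Fin m → ℤ) : Set ℤ := {p | ∃ i, s i ≤ p ∧ (m : ℤ) ∣ p - s i}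

/-- Each entry is the least element of its residue class in `aboveSet s`. -/
theorem mem_range_iff_aboveSet {m : ℕ} {s : Fin m → ℤ}
    (hs : ∀ i j, (m : ℤ) ∣ s i - s j → i = j) (p : ℤ) :
    p ∈ Set.range s ↔ p ∈ aboveSet s ∧ p - m ∉ aboveSet s := by
  constructor
  · rintro ⟨i, rfl⟩
    refine ⟨⟨i, le_rfl, by simp⟩, ?_⟩
    rintro ⟨j, h1, h2⟩
    have h3 : (m : ℤ) ∣ s i - s j := by
      have := dvd_add h2 (dvd_refl (m : ℤ))
      rwa [show s i - m - s j + m = s i - s j by ring] at this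
    obtain rfl := hs i j h3
    have := i.pos
    omega
  · rintro ⟨⟨i, h1, h2⟩, h3⟩
    rcases h1.eq_or_lt with h | h
    · exact ⟨i, h⟩
    · refine absurd ⟨i, ?_, ?_⟩ h3
      · have := Int.le_of_dvd (by omega) h2
        omega
      · rw [show p - m - s i = p - s i - m by ring]
        exact dvd_sub_self_right.mpr h2

/-- A residue class whose least element is below `s f` has exactly one element in this open window
of length `m`; the other classes have none. -/
theorem ncard_window {m : ℕ} {s : Fin m → ℤ} (hm : StrictMono s)
    (hs : ∀ i j, (m : ℤ) ∣ s i - s j → i = j) (f : Fin m) :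
    {p | p ∈ aboveSet s ∧ s f - m < p ∧ p < s f}.ncard = f := by
  have hm0 : (0 : ℤ) < m := by exact_mod_cast f.pos
  have h : {p | p ∈ aboveSet s ∧ s f - m < p ∧ p < s f} =
      (fun i => s f - (s f - s i) % m) '' Set.Iio f := by
    ext p
    constructor
    · rintro ⟨⟨i, h1, q, h2⟩, h3, h4⟩
      refine ⟨i, hm.lt_iff_lt.mp (by omega), ?_⟩
      have : (s f - s i) % m = s f - p := by
        rw [show s f - s i = s f - p + m * q by linarith, Int.add_mul_emod_self_left]
        exact Int.emod_eq_of_lt (by omega) (by omega)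
      simp only [this]; ring
    · rintro ⟨i, hi, rfl⟩
      have hi' : s i < s f := hm hi
      have h1 := Int.emod_nonneg (s f - s i) hm0.ne'
      have h2 := Int.emod_lt_of_pos (s f - s i) hm0
      have h3 : (s f - s i) % m ≠ 0 := fun h0 =>
        (show i < f from hi).ne' (hs f i (Int.dvd_of_emod_eq_zero h0))
      have h4 := Int.emod_add_mul_ediv (s f - s i) m
      have h5 : 0 ≤ m * ((s f - s i) / m) :=
        mul_nonneg hm0.le (Int.ediv_nonneg (by omega) hm0.le)
      refine ⟨⟨i, by dsimp only; omega, (s f - s i) / m, by dsimp only; linarith⟩, ?_, ?_⟩ <;>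
        dsimp only <;> omega
  rw [h, Set.ncard_image_of_injective, ← Finset.coe_Iio, Set.ncard_coe_finset, Fin.card_Iio]
  intro i j hij
  have h1 : s f - s i ≡ s f - s j [ZMOD m] := sub_right_injective hij
  have h2 := h1.dvd
  rw [sub_sub_sub_cancel_left] at h2
  exact hs i j h2

/-- Stability makes `{p | α ≤ ω p}` closed under adding `m`, and `ω p - p` is bounded. So each
residue class meets this set in a half-infinite progression, whose least element is taken. -/
theorem exists_sorted_minima {m n : ℕ} [NeZero n] (hm : 0 < m) {ω : Equiv.Perm ℤ}
    (hω : ω ∈ stablePerms m n) (α : ℤ) : ∃ s : Fin m → ℤ, StrictMono s ∧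
      (∀ i j, (m : ℤ) ∣ s i - s j → i = j) ∧ ∀ p, p ∈ aboveSet s ↔ α ≤ ω p := by
  obtain ⟨C, hC⟩ := exists_abs_map_sub_le (mem_affinePerms_iff.mp hω.1).1
  have hm0 : (1 : ℤ) ≤ m := by exact_mod_cast hm
  have hmono : ∀ p q : ℤ, p ≤ q → (m : ℤ) ∣ q - p → ω p ≤ ω q := by
    rintro p q hpq ⟨t, ht⟩
    have ht0 : 0 ≤ t := by
      by_contra! h
      have := mul_lt_mul_of_pos_left h (show (0 : ℤ) < m by omega)
      omega
    obtain rfl : q = p + m * t := by linarith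
    clear hpq ht
    induction t, ht0 using Int.leInduction with
    | base => simp
    | succ t _ ih =>
      have := hω.2 (p + m * t)
      rw [show p + m * (t + 1) = p + m * t + m by ring]
      omega
  have hleast : ∀ c : Fin m, ∃ p, ((m : ℤ) ∣ p - c ∧ α ≤ ω p) ∧
      ∀ z, ((m : ℤ) ∣ z - c ∧ α ≤ ω z) → p ≤ z := fun c => by
    refine Int.exists_least_of_bdd ⟨α - C, fun z hz => ?_⟩ ⟨c + m * (|α| + C), ⟨|α| + C, by ring⟩, ?_⟩
    · have := (abs_le.mp (hC z)).2
      linarith [hz.2]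
    · have h1 := (abs_le.mp (hC (c + m * (|α| + C)))).1
      have h2 : 0 ≤ C := (abs_nonneg _).trans (hC 0)
      have h3 := mul_le_mul_of_nonneg_right hm0 (add_nonneg (abs_nonneg α) h2)
      have h4 := le_abs_self α
      have h5 : (0 : ℤ) ≤ c := by positivity
      linarith
  choose r hr hr' using hleast
  have hres : ∀ c d, (m : ℤ) ∣ r c - r d → c = d := fun c d h => by
    have h1 := dvd_sub (dvd_add h (hr d).1) (hr c).1
    rw [show r c - r d + (r d - d) - (r c - c) = (c : ℤ) - d by ring] at h1
    exact fin_eq_of_dvd_sub h1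
  have hres' : ∀ i j, (m : ℤ) ∣ (r ∘ Tuple.sort r) i - (r ∘ Tuple.sort r) j → i = j :=
    fun i j h => (Tuple.sort r).injective (hres _ _ h)
  refine ⟨r ∘ Tuple.sort r, (Tuple.monotone_sort r).strictMono_of_injective fun i j h =>
    hres' i j (by rw [h, sub_self]; exact dvd_zero _), hres', fun p => ?_⟩
  constructor
  · rintro ⟨i, h1, h2⟩
    exact (hr _).2.trans (hmono _ _ h1 h2)
  · intro h
    have hp0 := Int.emod_nonneg p (show (m : ℤ) ≠ 0 by omega)
    have hp1 := Int.emod_lt_of_pos p (show (0 : ℤ) < m by omega)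
    set c : Fin m := ⟨(p % m).toNat, by omega⟩
    have hc : (m : ℤ) ∣ p - c := by
      change (m : ℤ) ∣ p - ((p % m).toNat : ℤ)
      rw [Int.toNat_of_nonneg hp0]
      exact Int.dvd_self_sub_emod
    refine ⟨(Tuple.sort r).symm c, ?_, ?_⟩
    · simpa using hr' c p ⟨hc, h⟩
    · have := dvd_sub hc (hr c).1
      rw [sub_sub_sub_cancel_right] at this
      simpa using this

theorem psMap_eq_of_aboveSet {m n : ℕ} {ω : Equiv.Perm ℤ} {a : Fin n} {s : Fin m → ℤ}
    {f : Fin m} (hs : StrictMono s) (hres : ∀ i j, (m : ℤ) ∣ s i - s j → i = j)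
    (hf : s f = ω⁻¹ ((a : ℤ) + 1)) (hD : ∀ p, p ∈ aboveSet s ↔ (a : ℤ) + 1 ≤ ω p) :
    psMap m n ω a = f := by
  set α := (a : ℤ) + 1 with hα
  rw [← ncard_window hs hres f, hf, psMap, ← hα,
    ← Set.ncard_image_of_injective _ ω⁻¹.injective]
  congr 1
  ext p
  simp only [Set.mem_ofPred_eq, hD, Set.mem_image]
  constructor
  · rintro ⟨β, ⟨h1, h2, h3⟩, rfl⟩
    exact ⟨by simp only [Equiv.Perm.inv_def, Equiv.apply_symm_apply]; omega, by omega, by omega⟩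
  · rintro ⟨h1, h2, h3⟩
    have h4 : ω p ≠ α := fun h => by
      rw [Equiv.Perm.inv_eq_iff_eq.mpr h.symm] at h3
      exact lt_irrefl _ h3
    have h5 : ω⁻¹ (ω p) = p := by simp
    exact ⟨ω p, ⟨by omega, by omega, by omega⟩, h5⟩

/-- Raising `α` by one removes only `ω⁻¹ α`, which stability makes the least element of its class,
so `ω⁻¹ α + m` replaces it. Its index counts the smaller minima, which by `ncard_window` is the
value of `PS`. -/
theorem exists_isTrackSystem {m n : ℕ} [NeZero n] (hm : 0 < m) {ω : Equiv.Perm ℤ}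
    (hω : ω ∈ stablePerms m n) : ∃ s f, IsTrackSystem m n s f ∧ (∀ α, s α (f α) = ω⁻¹ α) ∧
      (∀ α, f (α + n) = f α) ∧ ∀ a : Fin n, (f ((a : ℤ) + 1) : ℕ) = psMap m n ω a := by
  choose s hs hres hD using exists_sorted_minima hm hω
  have hper := (mem_affinePerms_iff.mp hω.1).1
  have hrange : ∀ α p, p ∈ Set.range (s α) ↔ α ≤ ω p ∧ ω (p - m) < α := fun α p => by
    rw [mem_range_iff_aboveSet (hres α), hD, hD, not_le]
  have hf : ∀ α, ∃ i, s α i = ω⁻¹ α := fun α => by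
    refine (hrange α _).mpr ⟨by simp, ?_⟩
    have := hω.2 (ω⁻¹ α - m)
    rw [sub_add_cancel] at this
    simpa using this
  choose f hf using hf
  have hperiod : ∀ α i, s (α + n) i = s α i + n := fun α i => by
    have : s (α + n) = fun i => s α i + n := by
      rw [← (hs (α + n)).range_inj (fun i j h => by simpa using hs α h)]
      ext p
      have h1 : p ∈ Set.range (fun i => s α i + n) ↔ p - n ∈ Set.range (s α) := by
        simp only [Set.mem_range, eq_sub_iff_add_eq]
      have h2 := hper (p - n)
      have h3 := hper (p - n - m)
      rw [sub_add_cancel] at h2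
      rw [show p - n - m + n = p - m by ring] at h3
      rw [h1, hrange, hrange, h2, h3]
      simp
    rw [this]
  refine ⟨s, f, ⟨hs, hres, fun α => ?_, hperiod⟩, hf, fun α => ?_, fun a => ?_⟩
  · set w : Fin m → ℤ := fun i => s α i + if i = f α then (m : ℤ) else 0
    have hw : Function.Injective w := fun i j h => by
      refine hres α i j ?_
      have h' : s α i - s α j = (if j = f α then (m : ℤ) else 0) - if i = f α then (m : ℤ) else 0 := by
        simp only [w] at h; linarith
      rw [h']
      split_ifs <;> simp
    refine exists_perm_of_range_eq hw (hs (α + 1)).injective ?_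
    ext p
    rw [hrange]
    constructor
    · rintro ⟨i, rfl⟩
      by_cases hi : i = f α
      · simp only [hi, if_true, hf, add_sub_cancel_right]
        have := hω.2 (ω⁻¹ α)
        simp only [Equiv.Perm.inv_def, Equiv.apply_symm_apply] at this ⊢
        omega
      · simp only [hi, if_false, add_zero]
        have h1 := (hrange α (s α i)).mp ⟨i, rfl⟩
        have h2 : ω (s α i) ≠ α := fun h => hi ((hs α).injective (by
          rw [hf, ← Equiv.Perm.inv_eq_iff_eq.mpr h.symm]))
        omega
    · rintro ⟨h1, h2⟩
      by_cases he : ω (p - m) = α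
      · refine ⟨f α, ?_⟩
        simp only [if_true, hf]
        rw [Equiv.Perm.inv_eq_iff_eq.mpr he.symm]; ring
      · obtain ⟨i, hi⟩ := (hrange α p).mpr ⟨by omega, by omega⟩
        refine ⟨i, ?_⟩
        have : i ≠ f α := fun h => by
          rw [h, hf] at hi
          rw [← hi] at h1
          simp at h1
        simp only [this, if_false, hi, add_zero]
  · apply (hs (α + n)).injective
    rw [hf, hperiod, hf, inv_map_add hper]
  · exact (psMap_eq_of_aboveSet (hs _) (hres _) (hf _) (hD _)).symm

/-! ### Injectivity of `PS`. -/

/-- Adding `m` at the same index keeps the differences `s - t`, and by the rearrangement inequality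
sorting both vectors cannot increase the squared distance. Periodicity forces equality throughout,
and the equality case says that one permutation sorts both. -/
theorem IsTrackSystem.exists_common_step {m n : ℕ} [NeZero n] {s t : ℤ → Fin m → ℤ}
    {f : ℤ → Fin m} (hs : IsTrackSystem m n s f) (ht : IsTrackSystem m n t f) (α : ℤ) :
    ∃ π : Equiv.Perm (Fin m), ∀ i,
      s (α + 1) (π i) = s α i + (if i = f α then (m : ℤ) else 0) ∧
      t (α + 1) (π i) = t α i + if i = f α then (m : ℤ) else 0 := by
  have hstep : ∀ α, ∃ π ρ : Equiv.Perm (Fin m),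
      (∀ i, s (α + 1) (π i) = s α i + if i = f α then (m : ℤ) else 0) ∧
      (∀ i, t (α + 1) (ρ (π i)) = t α i + if i = f α then (m : ℤ) else 0) ∧
      ∑ i, (s α i - t α i) ^ 2 - ∑ i, (s (α + 1) i - t (α + 1) i) ^ 2 =
        2 * (∑ i, s (α + 1) i * t (α + 1) i - ∑ i, s (α + 1) i * t (α + 1) (ρ i)) := fun α => by
    obtain ⟨π, hπ⟩ := hs.step α
    obtain ⟨π', hπ'⟩ := ht.step α
    have h' : ∀ i, t (α + 1) ((π.symm.trans π') (π i)) =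
        t α i + if i = f α then (m : ℤ) else 0 := fun i => by simp [hπ']
    refine ⟨π, π.symm.trans π', hπ, h', ?_⟩
    set ρ := π.symm.trans π'
    have h1 : ∑ i, (s α i - t α i) ^ 2 = ∑ i, (s (α + 1) i - t (α + 1) (ρ i)) ^ 2 := by
      rw [← Equiv.sum_comp π fun i => (s (α + 1) i - t (α + 1) (ρ i)) ^ 2]
      refine Finset.sum_congr rfl fun i _ => ?_
      rw [hπ, h', add_sub_add_right_eq_sub]
    have h2 : ∑ i, t (α + 1) (ρ i) ^ 2 = ∑ i, t (α + 1) i ^ 2 :=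
      Equiv.sum_comp ρ fun i => t (α + 1) i ^ 2
    rw [h1]
    simp only [sub_sq, Finset.sum_add_distrib, Finset.sum_sub_distrib, h2, mul_assoc,
      ← Finset.mul_sum]
    ring
  have hmv : ∀ α, Monovary (s α) (t α) := fun α =>
    (hs.strictMono α).monotone.monovary (ht.strictMono α).monotone
  have hanti : Antitone fun α => ∑ i, (s α i - t α i) ^ 2 := antitone_int_of_succ_le fun α => by
    obtain ⟨π, ρ, -, -, h⟩ := hstep α
    have := (hmv (α + 1)).sum_mul_comp_perm_le_sum_mul (σ := ρ)
    linarith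
  obtain ⟨π, ρ, h1, h2, h3⟩ := hstep α
  have hn : (1 : ℤ) ≤ n := by exact_mod_cast NeZero.pos n
  have h4 : ∑ i, (s α i - t α i) ^ 2 ≤ ∑ i, (s (α + 1) i - t (α + 1) i) ^ 2 := by
    have := hanti (show α + 1 ≤ α + n by omega)
    simpa only [hs.period, ht.period, add_sub_add_right_eq_sub] using this
  have h5 := (hmv (α + 1)).sum_mul_comp_perm_le_sum_mul (σ := ρ)
  have h6 := ((hmv (α + 1)).sum_mul_comp_perm_eq_sum_mul_iff (σ := ρ)).mp (by linarith)
  have hT := ht.strictMono (α + 1)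
  have h7 : Monotone (t (α + 1) ∘ ρ) := fun i j hij => by
    by_contra! hlt
    have := (hs.strictMono (α + 1)).le_iff_le.mp (h6 hlt)
    rw [le_antisymm hij this] at hlt
    exact lt_irrefl _ hlt
  have h8 : t (α + 1) ∘ ρ = t (α + 1) :=
    ((h7.strictMono_of_injective (hT.injective.comp ρ.injective)).range_inj hT).mp
      (ρ.surjective.range_comp _)
  refine ⟨π, fun i => ⟨h1 i, ?_⟩⟩
  rw [← h2 i]
  exact (congrFun h8 (π i)).symm

/-- If translating the entries of a vector by `-n` amounts to a permutation modulo `m`, with `m`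
and `n` coprime, then the permutation is transitive. -/
theorem exists_iterate_eq {m n : ℕ} (hmn : Nat.Coprime m n) {x : Fin m → ℝ}
    {P : Equiv.Perm (Fin m)} {c : Fin m → ℤ} (h : ∀ i, x (P i) = x i + m * c i - n)
    (i j : Fin m) : ∃ q : ℕ, q < m ∧ P^[q] i = j ∧ ∃ b : ℤ, x j = x i + m * b - n * q := by
  have hit : ∀ q : ℕ, ∃ b : ℤ, x (P^[q] i) = x i + m * b - n * q := fun q => by
    induction q with
    | zero => exact ⟨0, by simp⟩
    | succ q ih =>
      obtain ⟨b, hb⟩ := ih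
      refine ⟨b + c (P^[q] i), ?_⟩
      rw [Function.iterate_succ_apply', h, hb]
      push_cast; ring
  -- The entries along the orbit are `x i - n q` modulo `m`, distinct for `q < m` because `n` is
  -- invertible; so `m` iterates fill the index set.
  have hinj : Function.Injective fun q : Fin m => P^[q] i := fun q r hqr => by
    obtain ⟨b, hb⟩ := hit q
    obtain ⟨b', hb'⟩ := hit r
    simp only at hqr
    rw [hqr, hb'] at hb
    have h1 : (n : ℤ) * (q - r) = m * (b - b') := by
      have : (n : ℝ) * (q - r) = m * (b - b') := by linarith
      exact_mod_cast this
    apply fin_eq_of_dvd_sub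
    exact (Nat.isCoprime_iff_coprime.mpr hmn).dvd_of_dvd_mul_left ⟨_, h1⟩
  obtain ⟨q, hq⟩ := Finite.surjective_of_injective hinj j
  obtain ⟨b, hb⟩ := hit q
  refine ⟨q, q.isLt, hq, b, ?_⟩
  rw [← hb]; exact congrArg x hq.symm

/-- The common steps transport the differences `s - t` along the indices. Over one period the
resulting permutation is transitive, so all differences are equal. -/
theorem IsTrackSystem.exists_sub_eq {m n : ℕ} [NeZero n] (hm : 0 < m) (hmn : Nat.Coprime m n)
    {s t : ℤ → Fin m → ℤ} {f : ℤ → Fin m} (hs : IsTrackSystem m n s f)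
    (ht : IsTrackSystem m n t f) : ∃ c, ∀ α i, s α i - t α i = c := by
  have hN : ∀ (α : ℤ) (N : ℕ), ∃ (P : Equiv.Perm (Fin m)) (c : Fin m → ℤ), ∀ i,
      s (α + N) (P i) = s α i + m * c i ∧
      s (α + N) (P i) - t (α + N) (P i) = s α i - t α i := fun α N => by
    induction N with
    | zero => exact ⟨1, 0, fun i => by simp⟩
    | succ N ih =>
      obtain ⟨P, c, h⟩ := ih
      obtain ⟨π, h'⟩ := hs.exists_common_step ht (α + N)
      refine ⟨P.trans π, fun i => c i + if P i = f (α + N) then 1 else 0, fun i => ?_⟩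
      obtain ⟨h1, h2⟩ := h' (P i)
      obtain ⟨h3, h4⟩ := h i
      rw [show α + ((N + 1 : ℕ) : ℤ) = α + N + 1 by push_cast; ring, Equiv.trans_apply, h1, h2, h3]
      constructor
      · dsimp only; split_ifs <;> ring
      · linarith
  have hconst : ∀ α i j, s α i - t α i = s α j - t α j := fun α i j => by
    obtain ⟨P, c, h⟩ := hN α n
    obtain ⟨q, -, rfl, -⟩ := exists_iterate_eq hmn (x := fun i => (s α i : ℝ)) (P := P) (c := c)
      (fun i => by
        have := (h i).1
        rw [hs.period] at this
        have h' : s α (P i) = s α i + m * c i - n := by linarith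
        simp only [h']
        push_cast; ring) i j
    clear hN
    induction q with
    | zero => rfl
    | succ q ih =>
      rw [ih, Function.iterate_succ_apply']
      have := (h (P^[q] i)).2
      simpa only [hs.period, ht.period, add_sub_add_right_eq_sub] using this.symm
  set i₀ : Fin m := ⟨0, hm⟩
  have hsucc : ∀ α, s (α + 1) i₀ - t (α + 1) i₀ = s α i₀ - t α i₀ := fun α => by
    obtain ⟨π, h⟩ := hs.exists_common_step ht α
    rw [hconst (α + 1) i₀ (π i₀), (h i₀).1, (h i₀).2]; ring
  refine ⟨s 0 i₀ - t 0 i₀, fun α i => ?_⟩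
  rw [hconst α i i₀]
  induction α with
  | zero => rfl
  | succ α ih => rw [hsucc, ih]
  | pred α ih =>
    have := hsucc (-(α : ℤ) - 1)
    rw [sub_add_cancel] at this
    rw [← this, ih]

theorem eq_of_map_add_of_eq_on_fin {n : ℕ} [NeZero n] {X : Type*} {f g : ℤ → X}
    (hf : ∀ α, f (α + n) = f α) (hg : ∀ α, g (α + n) = g α)
    (h : ∀ a : Fin n, f ((a : ℤ) + 1) = g ((a : ℤ) + 1)) : f = g := by
  funext α
  obtain ⟨i, q, rfl⟩ := exists_eq_fin_add_mul n α
  have h1 : f ((i : ℤ) + 1 + q * n) = f ((i : ℤ) + 1) :=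
    (show Function.Periodic f (n : ℤ) from hf).int_mul q _
  have h2 : g ((i : ℤ) + 1 + q * n) = g ((i : ℤ) + 1) :=
    (show Function.Periodic g (n : ℤ) from hg).int_mul q _
  rw [h1, h2, h]

theorem injOn_psMap {m n : ℕ} [NeZero n] (hm : 0 < m) (hmn : Nat.Coprime m n) :
    Set.InjOn (psMap m n) (stablePerms m n) := by
  intro ω hω ω' hω' h
  obtain ⟨s, f, hs, hu, hf, hps⟩ := exists_isTrackSystem hm hω
  obtain ⟨t, g, ht, hu', hg, hps'⟩ := exists_isTrackSystem hm hω'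
  obtain rfl : f = g := eq_of_map_add_of_eq_on_fin hf hg fun a => by
    ext; rw [hps, hps', h]
  obtain ⟨c, hc⟩ := hs.exists_sub_eq hm hmn ht
  refine affinePerms_eq_of_order hω.1 hω'.1 fun a b hab => ?_
  have h1 := hc a (f a)
  have h2 := hc b (f b)
  rw [hu, hu'] at h1 h2
  omega

/-! ### Values of `PS` are parking functions. -/

theorem sum_indicator_le_sum_comp_perm {R : Type*} [CommRing R] [LinearOrder R]
    [IsStrictOrderedRing R] {m : ℕ} {x : Fin m → R} (hx : Monotone x) (π : Equiv.Perm (Fin m))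
    (j : ℕ) : ∑ i : Fin m, (if (i : ℕ) < j then (1 : R) else 0) * x i ≤
      ∑ i : Fin m, (if (i : ℕ) < j then (1 : R) else 0) * x (π i) := by
  have h : Antitone fun i : Fin m => if (i : ℕ) < j then (1 : R) else 0 := fun i k hik => by
    have : (i : ℕ) ≤ k := hik
    dsimp only
    split_ifs
    · rfl
    · omega
    · exact zero_le_one
    · rfl
  have hav : Antivary (fun i : Fin m => if (i : ℕ) < j then (1 : R) else 0) x := h.antivary hx
  exact hav.sum_mul_le_sum_mul_comp_perm (σ := π)

theorem card_filter_fin_lt (m j : ℕ) (h : j ≤ m) :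
    (Finset.univ.filter fun i : Fin m => (i : ℕ) < j).card = j := by
  rw [Fin.card_filter_val_lt, min_eq_right h]

/-- The sum of the `j` smallest entries grows at a step by at most `m` if the label is below `j`,
and otherwise not at all. Over a period it grows by exactly `n j`. -/
theorem IsTrackSystem.mul_le {m n : ℕ} {s : ℤ → Fin m → ℤ} {f : ℤ → Fin m}
    (hs : IsTrackSystem m n s f) {j : ℕ} (hj : j ≤ m) :
    n * j ≤ m * (Finset.univ.filter fun a : Fin n => (f ((a : ℤ) + 1) : ℕ) < j).card := by
  set B : ℤ → ℤ := fun α => ∑ i : Fin m, (if (i : ℕ) < j then (1 : ℤ) else 0) * s α i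
  have hstep : ∀ α, B (α + 1) ≤ B α + m * if (f α : ℕ) < j then 1 else 0 := fun α => by
    obtain ⟨π, hπ⟩ := hs.step α
    refine (sum_indicator_le_sum_comp_perm (hs.strictMono (α + 1)).monotone π j).trans_eq ?_
    simp only [hπ, mul_add, Finset.sum_add_distrib, B]
    congr 1
    rw [Finset.sum_eq_single (f α)]
    · simp [mul_comm]
    · intro i _ hi; simp [hi]
    · simp
  have hN : ∀ N : ℕ, B (1 + N) ≤ B 1 +
      m * ∑ a ∈ Finset.range N, if (f ((a : ℤ) + 1) : ℕ) < j then 1 else 0 := fun N => by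
    induction N with
    | zero => simp
    | succ N ih =>
      have := hstep (1 + N)
      rw [Finset.sum_range_succ, show (1 : ℤ) + ((N + 1 : ℕ) : ℤ) = 1 + N + 1 by push_cast; ring,
        mul_add, show (N : ℤ) + 1 = 1 + N by ring]
      linarith
  have hB : B (1 + n) = B 1 + n * j := by
    simp only [B, hs.period, mul_add, Finset.sum_add_distrib, ← Finset.sum_mul]
    rw [Finset.sum_boole, card_filter_fin_lt m j hj]; ring
  have h := hN n
  rw [hB, ← Fin.sum_univ_eq_sum_range
    (fun a => if (f ((a : ℤ) + 1) : ℕ) < j then (1 : ℤ) else 0) n, Finset.sum_boole] at h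
  have h' := (add_le_add_iff_left _).mp h
  exact_mod_cast h'

theorem mapsTo_psMap {m n : ℕ} [NeZero n] (hm : 0 < m) :
    Set.MapsTo (psMap m n) (stablePerms m n) (parkingFunctions m n) := by
  intro ω hω
  obtain ⟨s, f, hs, -, -, hps⟩ := exists_isTrackSystem hm hω
  rw [mem_parkingFunctions_iff hm]
  intro j hj
  have := hs.mul_le hj
  simpa only [hps] using this

/-! ### From track systems to stable permutations. -/

theorem IsTrackSystem.aboveSet_succ_subset {m n : ℕ} {s : ℤ → Fin m → ℤ} {f : ℤ → Fin m}
    (hs : IsTrackSystem m n s f) (α : ℤ) : aboveSet (s (α + 1)) ⊆ aboveSet (s α) := by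
  obtain ⟨π, hπ⟩ := hs.step α
  rintro p ⟨i, h1, h2⟩
  obtain ⟨i, rfl⟩ := π.surjective i
  rw [hπ] at h1 h2
  refine ⟨i, ?_, ?_⟩
  · split_ifs at h1 <;> omega
  · split_ifs at h2
    · rwa [← sub_sub, dvd_sub_self_right] at h2
    · rwa [add_zero] at h2

theorem IsTrackSystem.antitone_aboveSet {m n : ℕ} {s : ℤ → Fin m → ℤ} {f : ℤ → Fin m}
    (hs : IsTrackSystem m n s f) : Antitone fun α => aboveSet (s α) :=
  antitone_int_of_succ_le hs.aboveSet_succ_subset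

theorem IsTrackSystem.notMem_aboveSet_succ {m n : ℕ} {s : ℤ → Fin m → ℤ} {f : ℤ → Fin m}
    (hs : IsTrackSystem m n s f) (α : ℤ) : s α (f α) ∉ aboveSet (s (α + 1)) := by
  obtain ⟨π, hπ⟩ := hs.step α
  rintro ⟨i, h1, h2⟩
  obtain ⟨i, rfl⟩ := π.surjective i
  rw [hπ] at h1 h2
  have h3 : (m : ℤ) ∣ s α (f α) - s α i := by
    split_ifs at h2
    · rwa [← sub_sub, dvd_sub_self_right] at h2
    · rwa [add_zero] at h2
  obtain rfl := hs.residues α _ _ h3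
  have := (f α).pos
  rw [if_pos rfl] at h1
  omega

/-- The sets `aboveSet (s α)` decrease, and `s β (f β)` is lost at step `β`. The value `s β (f β)`
is therefore a candidate for `ω⁻¹ β`, with `aboveSet (s α)` in the role of `{p | α ≤ ω p}`. -/
theorem IsTrackSystem.mem_aboveSet_iff_le {m n : ℕ} {s : ℤ → Fin m → ℤ} {f : ℤ → Fin m}
    (hs : IsTrackSystem m n s f) (α β : ℤ) : s β (f β) ∈ aboveSet (s α) ↔ α ≤ β := by
  constructor
  · intro h
    by_contra! hlt
    exact hs.notMem_aboveSet_succ β (hs.antitone_aboveSet hlt h)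
  · intro h
    exact hs.antitone_aboveSet h ⟨f β, le_rfl, by simp⟩

theorem IsTrackSystem.injective {m n : ℕ} {s : ℤ → Fin m → ℤ} {f : ℤ → Fin m}
    (hs : IsTrackSystem m n s f) : Function.Injective fun α => s α (f α) := by
  intro α β h
  simp only at h
  apply le_antisymm
  · rw [← hs.mem_aboveSet_iff_le, ← h, hs.mem_aboveSet_iff_le]
  · rw [← hs.mem_aboveSet_iff_le, h, hs.mem_aboveSet_iff_le]

theorem IsTrackSystem.sub_const {m n : ℕ} {s : ℤ → Fin m → ℤ} {f : ℤ → Fin m}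
    (hs : IsTrackSystem m n s f) (c : ℤ) : IsTrackSystem m n (fun α i => s α i - c) f where
  strictMono α i j h := by simpa using hs.strictMono α h
  residues α i j h := hs.residues α i j (by rwa [sub_sub_sub_cancel_right] at h)
  step α := by
    obtain ⟨π, hπ⟩ := hs.step α
    exact ⟨π, fun i => by rw [hπ]; ring⟩
  period α i := by rw [hs.period]; ring

/-- Every periodic track system comes from a stable affine permutation. -/
theorem IsTrackSystem.exists_stablePerm {m n : ℕ} [NeZero n] {s : ℤ → Fin m → ℤ}
    {f : ℤ → Fin m} (hs : IsTrackSystem m n s f) (hf : ∀ α, f (α + n) = f α) :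
    ∃ ω ∈ stablePerms m n, ∀ a : Fin n, psMap m n ω a = f ((a : ℤ) + 1) := by
  obtain ⟨ρ, q, hq⟩ := exists_perm_residue (n := n) (w := fun α => s α (f α))
    (fun α => by simp only [hf, hs.period]) hs.injective
  -- The sum over a period exceeds the required one by `n ∑ q i`, so each of the `n` terms is
  -- lowered by `∑ q i`.
  replace hs := hs.sub_const (∑ i, q i)
  set s' : ℤ → Fin m → ℤ := fun α i => s α i - ∑ i, q i
  set U := Equiv.ofBijective (fun α => s' α (f α))
    (bijective_of_injective_of_map_add (n := n) (fun α => by simp only [hf, hs.period])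
      hs.injective) with hUdef
  have hU : U ∈ affinePerms n := by
    rw [mem_affinePerms_iff]
    refine ⟨fun α => ?_, ?_⟩
    · change s' (α + n) (f (α + n)) = s' α (f α) + n
      rw [hf, hs.period]
    · change ∑ i : Fin n, (s ((i : ℤ) + 1) (f ((i : ℤ) + 1)) - ∑ i, q i) = _
      rw [Finset.sum_sub_distrib, Finset.sum_congr rfl fun i _ => hq i, Finset.sum_add_distrib,
        ← Finset.sum_mul, Equiv.sum_comp ρ fun i => (i : ℤ) + 1]
      simp only [Finset.sum_const, Finset.card_univ, Fintype.card_fin, nsmul_eq_mul]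
      ring
  have hD : ∀ α p, p ∈ aboveSet (s' α) ↔ α ≤ U⁻¹ p := fun α p => by
    rw [← hs.mem_aboveSet_iff_le]
    change _ ↔ U (U⁻¹ p) ∈ _
    rw [Equiv.Perm.inv_def, Equiv.apply_symm_apply]
  refine ⟨U⁻¹, ⟨inv_mem_affinePerms hU, fun x => ?_⟩, fun a => ?_⟩
  · have h1 := (hD _ x).mpr le_rfl
    have h2 : x + m ∈ aboveSet (s' (U⁻¹ x)) := by
      obtain ⟨i, h1, h2⟩ := h1
      refine ⟨i, by omega, ?_⟩
      rw [show x + m - s' (U⁻¹ x) i = x - s' (U⁻¹ x) i + m by ring]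
      exact dvd_add_self_right.mpr h2
    refine lt_of_le_of_ne ((hD _ _).mp h2) fun h => ?_
    have := U⁻¹.injective h
    have := (f 0).pos
    omega
  · exact psMap_eq_of_aboveSet (hs.strictMono _) (hs.residues _) (by rw [inv_inv]; rfl) (hD _)

/-- Extend a sequence of sorted vectors with `Y n = Y 0 + n` periodically to all integers. -/
theorem exists_isTrackSystem_of_nat {m n : ℕ} [NeZero n] {Y : ℕ → Fin m → ℤ} {g : ℕ → Fin m}
    (hmono : ∀ t, StrictMono (Y t)) (hres : ∀ t i j, (m : ℤ) ∣ Y t i - Y t j → i = j)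
    (hstep : ∀ t, ∃ π : Equiv.Perm (Fin m), ∀ i,
      Y (t + 1) (π i) = Y t i + if i = g t then (m : ℤ) else 0)
    (hper : ∀ i, Y n i = Y 0 i + n) :
    ∃ s f, IsTrackSystem m n s f ∧ (∀ α, f (α + n) = f α) ∧
      ∀ a : Fin n, f ((a : ℤ) + 1) = g a := by
  have hn : (0 : ℤ) < n := by exact_mod_cast NeZero.pos n
  have hmod : ∀ α : ℤ, (α + n - 1) % n = (α - 1) % n := fun α => by
    rw [show α + n - 1 = α - 1 + n by ring, Int.add_emod_right]
  refine ⟨fun α i => Y ((α - 1) % n).toNat i + n * ((α - 1) / n),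
    fun α => g ((α - 1) % n).toNat, ⟨fun α i j h => ?_, fun α i j h => ?_, fun α => ?_, fun α i => ?_⟩,
    fun α => ?_, fun a => ?_⟩
  · simpa using hmono _ h
  · rw [add_sub_add_right_eq_sub] at h
    exact hres _ i j h
  · have h0 := Int.emod_nonneg (α - 1) hn.ne'
    have h1 := Int.emod_lt_of_pos (α - 1) hn
    have h2 := Int.emod_add_mul_ediv (α - 1) n
    obtain ⟨π, hπ⟩ := hstep ((α - 1) % n).toNat
    refine ⟨π, fun i => ?_⟩
    rw [add_sub_cancel_right]
    -- `Y 0` sits at `α = 1`. At the end of a block the step leads to `Y n`, which is identified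
    -- with `Y 0 + n` at the start of the next block.
    rcases (Int.add_one_le_of_lt h1).lt_or_eq with hlt | heq
    · have e := (Int.ediv_emod_unique (a := α) (b := n) (r := (α - 1) % n + 1)
        (q := (α - 1) / n) hn).mpr ⟨by linarith, by omega, hlt⟩
      rw [e.1, e.2, show ((α - 1) % n + 1).toNat = ((α - 1) % n).toNat + 1 by omega, hπ]
      ring
    · have e := (Int.ediv_emod_unique (a := α) (b := n) (r := 0)
        (q := (α - 1) / n + 1) hn).mpr ⟨by linarith, le_rfl, hn⟩
      have h3 := hπ i
      rw [show ((α - 1) % n).toNat + 1 = n by omega, hper] at h3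
      rw [e.1, e.2, Int.toNat_zero]
      linarith
  · simp only [hmod]
    rw [show α + n - 1 = α - 1 + n by ring, Int.add_ediv_of_dvd_right (dvd_refl _),
      Int.ediv_self hn.ne']
    ring
  · simp only [hmod]
  · have : ((a : ℤ) + 1 - 1) % n = a := by
      rw [add_sub_cancel_right]
      exact Int.emod_eq_of_lt (by positivity) (by exact_mod_cast a.isLt)
    simp only [this, Int.toNat_natCast]

/-! ### The real sorting process and its fixed point. -/

/-- Add `m` to the entry with index `f` and sort. -/
noncomputable def sortStep {m : ℕ} (f : Fin m) (x : Fin m → ℝ) : Fin m → ℝ :=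
  (x + Pi.single f (m : ℝ)) ∘ Tuple.sort (x + Pi.single f (m : ℝ))

theorem monotone_sortStep {m : ℕ} (f : Fin m) (x : Fin m → ℝ) : Monotone (sortStep f x) :=
  Tuple.monotone_sort _

theorem exists_perm_sortStep {m : ℕ} (f : Fin m) (x : Fin m → ℝ) :
    ∃ π : Equiv.Perm (Fin m), ∀ i, sortStep f x (π i) = x i + if i = f then (m : ℝ) else 0 :=
  ⟨(Tuple.sort (x + Pi.single f (m : ℝ))).symm, fun i => by simp [sortStep, Pi.single_apply]⟩

/-- The `i`-th sorted entry is at most `a` iff more than `i` entries are at most `a`. This makes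
sorting nonexpansive in the sup metric. -/
theorem sort_le_sort_add {m : ℕ} {v w : Fin m → ℝ} {c : ℝ} (h : ∀ i, v i ≤ w i + c) (i : Fin m) :
    (v ∘ Tuple.sort v) i ≤ (w ∘ Tuple.sort w) i + c := by
  have hcard : ∀ (v : Fin m → ℝ) (a : ℝ), (Finset.univ.filter fun k =>
      (v ∘ Tuple.sort v) k ≤ a).card = (Finset.univ.filter fun k => v k ≤ a).card := fun v a => by
    rw [← Finset.card_map (Tuple.sort v).toEmbedding]
    congr 1
    ext k
    simp [Finset.mem_map_equiv]
  have hv := Tuple.lt_card_le_iff_apply_le_of_monotone (j := i) (a := (w ∘ Tuple.sort w) i + c)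
    (Tuple.monotone_sort v)
  have hw := Tuple.lt_card_le_iff_apply_le_of_monotone (j := i) (a := (w ∘ Tuple.sort w) i)
    (Tuple.monotone_sort w)
  rw [hcard] at hv hw
  refine hv.mp ((hw.mpr le_rfl).trans_le (Finset.card_le_card fun k hk => ?_))
  simp only [Finset.mem_filter, Finset.mem_univ, true_and] at hk ⊢
  exact (h k).trans (by linarith)

theorem dist_sortStep_le {m : ℕ} (f : Fin m) (x y : Fin m → ℝ) :
    dist (sortStep f x) (sortStep f y) ≤ dist x y := by
  rw [dist_pi_le_iff dist_nonneg]
  intro i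
  have h : ∀ x y : Fin m → ℝ, ∀ i,
      (x + Pi.single f (m : ℝ) : Fin m → ℝ) i ≤ (y + Pi.single f (m : ℝ) : Fin m → ℝ) i + dist x y := fun x y i => by
    have h1 := dist_le_pi_dist x y i
    rw [Real.dist_eq] at h1
    have := (abs_le.mp h1).2
    simp only [Pi.add_apply]
    linarith
  rw [Real.dist_eq, abs_le]
  have h1 := sort_le_sort_add (h x y) i
  have h2 := sort_le_sort_add (h y x) i
  rw [dist_comm y x] at h2
  change sortStep f x i ≤ sortStep f y i + _ at h1
  change sortStep f y i ≤ sortStep f x i + _ at h2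
  constructor <;> linarith

/-- The vectors obtained from `x` by the successive sorting steps with indices `f 0, f 1, …`. -/
noncomputable def sortRun {m : ℕ} (f : ℕ → Fin m) (x : Fin m → ℝ) : ℕ → Fin m → ℝ
  | 0 => x
  | t + 1 => sortStep (f t) (sortRun f x t)

theorem dist_sortRun_le {m : ℕ} (f : ℕ → Fin m) (x y : Fin m → ℝ) (t : ℕ) :
    dist (sortRun f x t) (sortRun f y t) ≤ dist x y := by
  induction t with
  | zero => exact le_rfl
  | succ t ih => exact (dist_sortStep_le _ _ _).trans ih

theorem sum_sortRun {m : ℕ} (f : ℕ → Fin m) (x : Fin m → ℝ) (t : ℕ) :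
    ∑ i, sortRun f x t i = ∑ i, x i + m * t := by
  induction t with
  | zero => simp [sortRun]
  | succ t ih =>
    obtain ⟨π, hπ⟩ := exists_perm_sortStep (f t) (sortRun f x t)
    rw [sortRun, ← Equiv.sum_comp π]
    simp only [hπ, Finset.sum_add_distrib, ih]
    simp; ring

theorem exists_perm_sortRun {m : ℕ} (f : ℕ → Fin m) (x : Fin m → ℝ) (t : ℕ) :
    ∃ (P : Equiv.Perm (Fin m)) (c : Fin m → ℤ), ∀ i, sortRun f x t (P i) = x i + m * c i := by
  induction t with
  | zero => exact ⟨1, 0, fun i => by simp [sortRun]⟩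
  | succ t ih =>
    obtain ⟨P, c, h⟩ := ih
    obtain ⟨π, hπ⟩ := exists_perm_sortStep (f t) (sortRun f x t)
    refine ⟨P.trans π, fun i => c i + if P i = f t then 1 else 0, fun i => ?_⟩
    rw [sortRun, Equiv.trans_apply, hπ, h]
    dsimp only
    split_ifs <;> push_cast <;> ring

theorem monotone_sortRun {m : ℕ} (f : ℕ → Fin m) {x : Fin m → ℝ} (hx : Monotone x) (t : ℕ) :
    Monotone (sortRun f x t) := by
  cases t with
  | zero => exact hx
  | succ t => exact monotone_sortStep _ _

/-- A sorting permutation preserves the first `j` indices if there is a gap above their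
entries. -/
theorem lt_iff_of_gap {m : ℕ} {y v : Fin m → ℝ} (hy : Monotone y) {π : Equiv.Perm (Fin m)}
    (hπ : ∀ i, y (π i) = v i) {j : ℕ}
    (hgap : ∀ i k : Fin m, (i : ℕ) < j → j ≤ (k : ℕ) → v i < v k) (i : Fin m) :
    (π i : ℕ) < j ↔ (i : ℕ) < j := by
  set S := Finset.univ.filter fun i : Fin m => (i : ℕ) < j
  have hmem : ∀ i, i ∈ S ↔ (i : ℕ) < j := fun i => by simp [S]
  have hlow : ∀ i : Fin m, (i : ℕ) < j → (π i : ℕ) < j := fun i hi => by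
    by_contra! hge
    -- If a low index moved up, every high index would stay up, being above it. The high indices
    -- would then be permuted among themselves, leaving no room for the low one.
    have hup : ∀ k : Fin m, k ∈ Sᶜ → π k ∈ Sᶜ := fun k hk => by
      rw [Finset.mem_compl, hmem, not_lt] at hk ⊢
      by_contra! hlt
      have h1 := hgap i k hi hk
      rw [← hπ, ← hπ] at h1
      exact h1.not_ge (hy (Fin.le_def.mpr (by omega)))
    have hsub : Sᶜ.map π.toEmbedding ⊆ Sᶜ := fun a ha => by
      obtain ⟨k, hk, rfl⟩ := Finset.mem_map.mp ha
      exact hup k hk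
    have heq := Finset.eq_of_subset_of_card_le hsub (by rw [Finset.card_map])
    have : π i ∈ Sᶜ := by rw [Finset.mem_compl, hmem]; omega
    rw [← heq, Finset.mem_map_equiv, Equiv.symm_apply_apply, Finset.mem_compl, hmem] at this
    exact this hi
  refine ⟨fun h => ?_, hlow i⟩
  have hsub : S.map π.toEmbedding ⊆ S := fun a ha => by
    obtain ⟨k, hk, rfl⟩ := Finset.mem_map.mp ha
    exact (hmem _).mpr (hlow k ((hmem k).mp hk))
  have heq := Finset.eq_of_subset_of_card_le hsub (by rw [Finset.card_map])
  rw [← hmem, ← heq, Finset.mem_map_equiv, Equiv.symm_apply_apply, hmem] at h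
  exact h

/-- One step narrows a gap by at most `m`; while the gap stays positive, the two blocks are sorted
separately. -/
theorem sortStep_gap {m : ℕ} (f : Fin m) (x : Fin m → ℝ) {j : ℕ} {G : ℝ} (hG : 0 < G)
    (hgap : ∀ i k : Fin m, (i : ℕ) < j → j ≤ (k : ℕ) → x i + (G + m) ≤ x k) :
    (∀ i k : Fin m, (i : ℕ) < j → j ≤ (k : ℕ) → sortStep f x i + G ≤ sortStep f x k) ∧
    ∑ i : Fin m, (if (i : ℕ) < j then (1 : ℝ) else 0) * sortStep f x i =
      ∑ i : Fin m, (if (i : ℕ) < j then (1 : ℝ) else 0) * x i +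
        m * if (f : ℕ) < j then 1 else 0 := by
  obtain ⟨π, hπ⟩ := exists_perm_sortStep f x
  have hv : ∀ i k : Fin m, (i : ℕ) < j → j ≤ (k : ℕ) →
      x i + (if i = f then (m : ℝ) else 0) + G ≤ x k + if k = f then (m : ℝ) else 0 := by
    intro i k hi hk
    have h1 := hgap i k hi hk
    have h2 : (if i = f then (m : ℝ) else 0) ≤ m := by split_ifs <;> simp
    have h3 : 0 ≤ if k = f then (m : ℝ) else 0 := by split_ifs <;> simp
    linarith
  have hlt := lt_iff_of_gap (monotone_sortStep f x) hπ (j := j) fun i k hi hk => by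
    have := hv i k hi hk
    linarith
  constructor
  · intro i k hi hk
    obtain ⟨i, rfl⟩ := π.surjective i
    obtain ⟨k, rfl⟩ := π.surjective k
    rw [hlt] at hi
    rw [hπ, hπ]
    exact hv i k hi (by by_contra! h; exact hk.not_gt ((hlt k).mpr h))
  · rw [← Equiv.sum_comp π]
    simp only [hlt, hπ, mul_add, Finset.sum_add_distrib]
    congr 1
    rw [Finset.sum_eq_single f]
    · simp [mul_comm]
    · intro i _ hi; simp [hi]
    · simp

theorem sum_sortRun_of_gap {m : ℕ} (f : ℕ → Fin m) (x : Fin m → ℝ) {j : ℕ} (t : ℕ) {G : ℝ}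
    (hG : 0 < G)
    (hgap : ∀ i k : Fin m, (i : ℕ) < j → j ≤ (k : ℕ) → x i + (G + m * t) ≤ x k) :
    (∀ i k : Fin m, (i : ℕ) < j → j ≤ (k : ℕ) → sortRun f x t i + G ≤ sortRun f x t k) ∧
    ∑ i : Fin m, (if (i : ℕ) < j then (1 : ℝ) else 0) * sortRun f x t i =
      ∑ i : Fin m, (if (i : ℕ) < j then (1 : ℝ) else 0) * x i +
        m * ∑ a ∈ Finset.range t, if (f a : ℕ) < j then 1 else 0 := by
  induction t generalizing G with
  | zero => simpa [sortRun] using hgap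
  | succ t ih =>
    obtain ⟨h1, h2⟩ := ih (G := G + m) (by positivity) fun i k hi hk => by
      have := hgap i k hi hk
      push_cast at this
      linarith
    obtain ⟨h3, h4⟩ := sortStep_gap (f t) (sortRun f x t) hG h1
    refine ⟨h3, ?_⟩
    rw [sortRun, h4, h2, Finset.sum_range_succ]
    ring

/-- A damped fixed point of the normalized sorting process of a parking function is bounded
independently of the damping. -/
theorem abs_le_of_damped_fixed {m n : ℕ} (hn : 0 < n) {f : ℕ → Fin m}
    (hf : ∀ j ≤ m, n * j ≤ m * ∑ a ∈ Finset.range n, if (f a : ℕ) < j then 1 else 0)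
    {δ : ℝ} (hδ0 : 0 < δ) (hδ1 : δ < 1) {x : Fin m → ℝ}
    (hx : ∀ i, x i = δ * (sortRun f x n i - n)) (i : Fin m) : |x i| ≤ (1 + m * n) * m := by
  have hmono : Monotone x := fun i k hik => by
    rw [hx i, hx k]
    obtain ⟨t, rfl⟩ := Nat.exists_eq_succ_of_ne_zero hn.ne'
    have : sortRun f x (t + 1) i ≤ sortRun f x (t + 1) k := monotone_sortStep _ _ hik
    gcongr
  have hsum : ∑ i, x i = 0 := by
    have h1 : ∑ i, x i = δ * ∑ i, (sortRun f x n i - n) := by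
      rw [Finset.mul_sum]; exact Finset.sum_congr rfl fun i _ => hx i
    rw [Finset.sum_sub_distrib, sum_sortRun] at h1
    simp only [Finset.sum_const, Finset.card_univ, Fintype.card_fin, nsmul_eq_mul] at h1
    have h2 : (1 - δ) * ∑ i, x i = 0 := by linarith
    exact (mul_eq_zero.mp h2).resolve_left (by linarith)
  -- A gap of `1 + m n` would stay at least `1` during `n` steps, so the lower block would evolve by
  -- itself.
  have hgap : ∀ j : ℕ, 0 < j → j < m → ∃ i k : Fin m, (i : ℕ) < j ∧ j ≤ (k : ℕ) ∧
      x k < x i + (1 + m * n) := by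
    intro j hj0 hjm
    by_contra! hno
    obtain ⟨-, hB⟩ := sum_sortRun_of_gap f x n one_pos hno
    set B := ∑ i : Fin m, (if (i : ℕ) < j then (1 : ℝ) else 0) * x i
    have h1 : B = δ * (∑ i : Fin m, (if (i : ℕ) < j then (1 : ℝ) else 0) * sortRun f x n i -
        n * j) := by
      have e : (n : ℝ) * j = ∑ i : Fin m, (if (i : ℕ) < j then (1 : ℝ) else 0) * n := by
        rw [← Finset.sum_mul, Finset.sum_boole, card_filter_fin_lt m j hjm.le, mul_comm]
      rw [e, ← Finset.sum_sub_distrib, Finset.mul_sum]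
      refine Finset.sum_congr rfl fun i _ => ?_
      rw [← mul_sub, hx i]; ring
    have h2 : (n : ℝ) * j ≤ m * ∑ a ∈ Finset.range n, if (f a : ℕ) < j then 1 else 0 := by
      exact_mod_cast hf j hjm.le
    -- The parking inequality turns the fixed point equation into `B ≥ δ B`. But a nonnegative lower
    -- block forces every entry above the gap to be positive, contradicting the total sum zero.
    have h3 : 0 ≤ B := by
      rw [hB] at h1
      have h4 : δ * B ≤ B := by
        nth_rw 2 [h1]
        exact mul_le_mul_of_nonneg_left (by linarith) hδ0.le
      by_contra! hneg
      have := mul_pos_of_neg_of_neg (show δ - 1 < 0 by linarith) hneg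
      linarith
    obtain ⟨i, hi, hi0⟩ : ∃ i : Fin m, (i : ℕ) < j ∧ 0 ≤ x i := by
      by_contra! hneg
      refine h3.not_gt (Finset.sum_neg' (fun i _ => ?_) ⟨⟨0, by omega⟩, Finset.mem_univ _, ?_⟩)
      · split_ifs with h
        · simpa using (hneg i h).le
        · simp
      · simpa [hj0] using hneg ⟨0, by omega⟩ hj0
    have hup : ∀ k : Fin m, j ≤ (k : ℕ) → 0 < x k := fun k hk => by
      have := hno i k hi hk
      have : (0 : ℝ) ≤ m * n := by positivity
      linarith
    have h5 : 0 < ∑ i : Fin m, (x i - (if (i : ℕ) < j then (1 : ℝ) else 0) * x i) := by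
      refine Finset.sum_pos' (fun i _ => ?_) ⟨⟨j, hjm⟩, Finset.mem_univ _, ?_⟩
      · split_ifs with h
        · simp
        · simpa using (hup i (by omega)).le
      · simpa using hup ⟨j, hjm⟩ le_rfl
    rw [Finset.sum_sub_distrib, hsum] at h5
    linarith
  have hC : (0 : ℝ) ≤ 1 + m * n := by positivity
  have hlin : ∀ (t : ℕ) (ht : t < m), x ⟨t, ht⟩ ≤ x ⟨0, by omega⟩ + (1 + m * n) * t := by
    intro t
    induction t with
    | zero => intro ht; simp
    | succ t ih =>
      intro ht
      obtain ⟨i, k, hi, hk, hlt⟩ := hgap (t + 1) (by omega) ht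
      have h1 : x ⟨t + 1, ht⟩ ≤ x k := hmono (Fin.le_def.mpr hk)
      have h2 : x i ≤ x ⟨t, by omega⟩ := hmono (Fin.le_def.mpr (by dsimp only; omega))
      have h3 := ih (by omega)
      push_cast
      linarith
  refine abs_le_of_forall_sub_le hsum (fun i k => ?_) i
  have h1 := hlin i i.isLt
  have h2 : x ⟨0, i.pos⟩ ≤ x k := hmono (Fin.le_def.mpr (Nat.zero_le _))
  have h3 : (1 + (m : ℝ) * n) * (i : ℕ) ≤ (1 + m * n) * m :=
    mul_le_mul_of_nonneg_left (by exact_mod_cast i.isLt.le) hC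
  simp only [Fin.eta] at h1
  linarith

/-- The sorting process of a parking function has a periodic point up to translation. -/
theorem exists_sortRun_eq_add {m n : ℕ} (hn : 0 < n) {f : ℕ → Fin m}
    (hf : ∀ j ≤ m, n * j ≤ m * ∑ a ∈ Finset.range n, if (f a : ℕ) < j then 1 else 0) :
    ∃ x : Fin m → ℝ, ∀ i, sortRun f x n i = x i + n := by
  set F : (Fin m → ℝ) → Fin m → ℝ := fun x i => sortRun f x n i - n with hF
  set M : ℝ := (1 + m * n) * m with hM
  have hM0 : 0 ≤ M := by positivity
  have hFdist : ∀ x y, dist (F x) (F y) ≤ dist x y := fun x y => by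
    refine le_trans (le_of_eq ?_) (dist_sortRun_le f x y n)
    simp only [hF, dist_pi_def, nndist_sub_right]
  have hdamp : ∀ δ : ℝ, 0 < δ → δ < 1 → ∃ x ∈ Metric.closedBall (0 : Fin m → ℝ) M,
      x = δ • F x := by
    intro δ h0 h1
    have hcontr : ContractingWith δ.toNNReal fun x => δ • F x := by
      refine ⟨by simpa using h1, LipschitzWith.of_dist_le_mul fun x y => ?_⟩
      rw [dist_smul₀, Real.norm_of_nonneg h0.le, Real.coe_toNNReal _ h0.le]
      exact mul_le_mul_of_nonneg_left (hFdist x y) h0.le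
    have hfix : hcontr.fixedPoint _ = δ • F (hcontr.fixedPoint _) :=
      hcontr.fixedPoint_isFixedPt.symm
    refine ⟨hcontr.fixedPoint _, ?_, hfix⟩
    rw [mem_closedBall_zero_iff, pi_norm_le_iff_of_nonneg hM0]
    exact abs_le_of_damped_fixed hn hf h0 h1 fun i => congrFun hfix i
  have hcont : Continuous fun x => dist (F x) x := by
    have : Continuous F := (LipschitzWith.of_dist_le_mul (K := 1) fun x y => by
      simpa using hFdist x y).continuous
    fun_prop
  -- Damped fixed points lie in this ball for every damping and have arbitrarily small displacement
  -- under `F`, so the minimum of the displacement is zero.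
  obtain ⟨x, -, hmin⟩ := (isCompact_closedBall (0 : Fin m → ℝ) M).exists_isMinOn
    ⟨0, Metric.mem_closedBall_self hM0⟩ hcont.continuousOn
  refine ⟨x, fun i => ?_⟩
  have hzero : dist (F x) x = 0 := by
    refine le_antisymm (le_of_forall_pos_le_add fun η hη => ?_) dist_nonneg
    -- For the fixed point `y` of `(1 - ε) F`, `(1 - ε) dist (F y) y = ε ‖y‖ ≤ ε M`. With `ε ≤ 1 /
    -- 2` the displacement is at most `2 ε M ≤ η`.
    set ε := min (1 / 2) (η / (2 * (M + 1))) with hε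
    have hε0 : 0 < ε := by positivity
    have hε1 : ε ≤ 1 / 2 := min_le_left _ _
    have hε2 : ε * (2 * (M + 1)) ≤ η := by
      rw [← le_div_iff₀ (by positivity)]; exact min_le_right _ _
    obtain ⟨y, hy, hfix⟩ := hdamp (1 - ε) (by linarith) (by linarith)
    refine (isMinOn_iff.mp hmin y hy).trans ?_
    rw [zero_add]
    have h1 : (1 - ε) • (F y - y) = ε • y := by
      have : (1 - ε) • F y = y := hfix.symm
      rw [smul_sub, this, sub_smul, one_smul]; abel
    have h2 : (1 - ε) * dist (F y) y = ε * ‖y‖ := by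
      rw [dist_eq_norm]
      have := congrArg norm h1
      rwa [norm_smul, norm_smul, Real.norm_of_nonneg (by linarith),
        Real.norm_of_nonneg hε0.le] at this
    have h3 : ‖y‖ ≤ M := mem_closedBall_zero_iff.mp hy
    have h4 := mul_le_mul_of_nonneg_left h3 hε0.le
    have h5 := mul_le_mul_of_nonneg_right hε1 (dist_nonneg (x := F y) (y := y))
    linarith
  have := congrFun (dist_eq_zero.mp hzero) i
  simp only [hF] at this
  linarith

/-! ### Surjectivity of `PS` and the assembled theorem. -/

theorem surjOn_psMap {m n : ℕ} [NeZero n] (hm : 0 < m) (hmn : Nat.Coprime m n) :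
    Set.SurjOn (psMap m n) (stablePerms m n) (parkingFunctions m n) := by
  intro g hg
  rw [mem_parkingFunctions_iff hm] at hg
  have hn := NeZero.pos n
  have hglt := lt_of_forall_mul_le_card hm hg
  set f : ℕ → Fin m := fun t => ⟨g ⟨t % n, Nat.mod_lt _ hn⟩, hglt _⟩ with hf
  have hfg : ∀ a : Fin n, (f a : ℕ) = g a := fun a => by
    simp only [hf, Nat.mod_eq_of_lt a.isLt]
  obtain ⟨x, hx⟩ := exists_sortRun_eq_add hn (f := f) fun j hj => by
    rw [← Fin.sum_univ_eq_sum_range (fun a => if (f a : ℕ) < j then 1 else 0) n]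
    simp only [hfg]
    rw [Finset.sum_boole]
    exact hg j hj
  have hxmono : Monotone x := fun i k hik => by
    obtain ⟨t, ht⟩ := Nat.exists_eq_succ_of_ne_zero hn.ne'
    have h1 : sortRun f x (t + 1) i ≤ sortRun f x (t + 1) k := monotone_sortStep _ _ hik
    rw [← Nat.succ_eq_add_one, ← ht, hx, hx] at h1
    linarith
  set i₀ : Fin m := ⟨0, hm⟩
  obtain ⟨P, c, hP⟩ := exists_perm_sortRun f x n
  have hP' : ∀ i, x (P i) = x i + m * c i - n := fun i => by
    have := hP i
    rw [hx] at this
    linarith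
  -- Transitivity of the period permutation makes all entries congruent modulo `1`, and `hres` shows
  -- that they are distinct modulo `m`. So subtracting `x i₀` yields an integral track system.
  have hint : ∀ i, ∃ z : ℤ, x i = x i₀ + z := fun i => by
    obtain ⟨q, -, -, b, hb⟩ := exists_iterate_eq hmn hP' i₀ i
    exact ⟨m * b - n * q, by rw [hb]; push_cast; ring⟩
  have hres : ∀ i j, (∃ z : ℤ, x i - x j = m * z) → i = j := by
    rintro i j ⟨z, hz⟩
    obtain ⟨q, hqm, rfl, b, hb⟩ := exists_iterate_eq hmn hP' i j
    have h1 : (n : ℝ) * q = m * (z + b) := by linarith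
    have h2 : (n : ℤ) * q = m * (z + b) := by exact_mod_cast h1
    have h3 := (Nat.isCoprime_iff_coprime.mpr hmn).dvd_of_dvd_mul_left ⟨_, h2⟩
    have h4 := Nat.eq_zero_of_dvd_of_lt (Int.natCast_dvd_natCast.mp h3) hqm
    rw [h4]; rfl
  have hrun : ∀ t i, ∃ z : ℤ, sortRun f x t i = x i₀ + z := fun t i => by
    obtain ⟨Q, d, h⟩ := exists_perm_sortRun f x t
    obtain ⟨k, rfl⟩ := Q.surjective i
    obtain ⟨z, hz⟩ := hint k
    exact ⟨z + m * d k, by rw [h, hz]; push_cast; ring⟩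
  choose Y hY using hrun
  have hYres : ∀ t i j, (m : ℤ) ∣ Y t i - Y t j → i = j := by
    rintro t i j ⟨z, hz⟩
    obtain ⟨Q, d, h⟩ := exists_perm_sortRun f x t
    obtain ⟨i, rfl⟩ := Q.surjective i
    obtain ⟨j, rfl⟩ := Q.surjective j
    have h1 := h i
    have h2 := h j
    rw [hY] at h1 h2
    have h3 : ((Y t (Q i) : ℝ)) - Y t (Q j) = m * z := by exact_mod_cast hz
    rw [hres i j ⟨z - d i + d j, by push_cast; linarith⟩]
  obtain ⟨s, f', hs, hf', hff'⟩ := exists_isTrackSystem_of_nat (Y := Y) (g := f)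
    (fun t => Monotone.strictMono_of_injective (fun i k hik => by
      have h1 := monotone_sortRun f hxmono t hik
      rw [hY, hY] at h1
      exact_mod_cast (add_le_add_iff_left _).mp h1)
      fun i j h => hYres t i j (by rw [h, sub_self]; exact dvd_zero _)) hYres
    (fun t => by
      obtain ⟨π, hπ⟩ := exists_perm_sortStep (f t) (sortRun f x t)
      refine ⟨π, fun i => ?_⟩
      have h1 := hπ i
      change sortRun f x (t + 1) (π i) = _ at h1
      rw [hY, hY, add_assoc] at h1
      have h2 := (add_right_inj _).mp h1
      split_ifs at h2 ⊢ <;> exact_mod_cast h2)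
    (fun i => by
      have h1 := hx i
      have h2 := hY 0 i
      change x i = _ at h2
      rw [hY, h2, add_assoc] at h1
      exact_mod_cast (add_right_inj _).mp h1)
  obtain ⟨ω, hω, hps⟩ := hs.exists_stablePerm hf'
  exact ⟨ω, hω, funext fun a => by rw [hps, hff', hfg]⟩

theorem bijOn_psMap {m n : ℕ} [NeZero n] (hm : 0 < m) (hmn : Nat.Coprime m n) :
    Set.BijOn (psMap m n) (stablePerms m n) (parkingFunctions m n) :=
  ⟨mapsTo_psMap hm, injOn_psMap hm hmn, surjOn_psMap hm hmn⟩

theorem parkingFunctions_subset {m m' n : ℕ} (h : m ≤ m') :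
    parkingFunctions m n ⊆ parkingFunctions m' n := by
  rintro f ⟨σ, hσ, hf⟩
  refine ⟨σ, hσ, fun i => ?_⟩
  have h1 := hf i
  have h2 := i.isLt
  obtain ⟨d, rfl⟩ := Nat.exists_eq_add_of_le h
  have h3 := Nat.mul_le_mul_left d (show (i : ℕ) + 1 ≤ n from h2)
  rw [add_mul, add_mul]
  omega

theorem coprime_mul_sub_one {n k : ℕ} (hm : 1 < k * n) : Nat.Coprime (k * n - 1) n := by
  refine Nat.Coprime.coprime_dvd_right (Dvd.intro_left k rfl) ?_
  have h : Nat.Coprime (k * n - 1) (k * n - 1 + 1) := by simp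
  rwa [Nat.sub_add_cancel hm.le] at h

/-- The image of the Pak–Stanley labeling follows formally from the bijections `balc` and `psMap`
and their compatibility. -/
theorem mainTheorem4 (n k : ℕ) [NeZero n] (hm : 1 < k * n) :
    Set.BijOn (balc n k) (stablePerms (k * n - 1) n) (boundedShiRegions n k) ∧
    (∀ ω ∈ stablePerms (k * n - 1) n, IsMaximalAlcove (alcoveOf n ω) (balc n k ω)) ∧
    pakStanley n k '' boundedShiRegions n k = parkingFunctions (k * n - 1) n ∧
    parkingFunctions (k * n - 1) n ⊆ parkingFunctions (k * n + 1) n ∧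
    (∀ ω ∈ stablePerms (k * n - 1) n, pakStanley n k (balc n k ω) = psMap (k * n - 1) n ω) ∧
    Set.BijOn (psMap (k * n - 1) n) (stablePerms (k * n - 1) n)
      (parkingFunctions (k * n - 1) n) := by
  have hps := bijOn_psMap (Nat.sub_pos_of_lt hm) (coprime_mul_sub_one hm)
  refine ⟨bijOn_balc hm, fun ω => isMaximalAlcove_balc hm, ?_, parkingFunctions_subset (by omega),
    fun ω => pakStanley_balc hm, hps⟩
  rw [← (bijOn_balc hm).image_eq, Set.image_image, ← hps.image_eq]
  exact Set.image_congr fun ω => pakStanley_balc hm
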